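/- Let $m>2$ and let $e_1$ be the first standard basis vector of $\mathbf R^m$, so that $e_1\in S^{m-1}\subset\mathbf R^m$. There are constants $A_0,A_1,A_2,\dots$ such that for every $\varepsilon>0$ and $C>0$ there is a smooth map $f:\mathbf R\to S^{m-1}$ with $f-e_1$ supported in $[-C,C]$ and $$\sup_{x\in\mathbf R}\bigl|\partial_x^k(f-e_1)(x)\bigr|\le A_k\,\varepsilon\qquad\text{for all }k\ge 0$$ (that is, $\|f-e_1\|_{C_0^\infty}\lesssim\varepsilon$, the implied constant depending on the order of the derivative), for which the following holds. The Cauchy problem for wave maps from $\mathbf R^{1+1}$ to $S^{m-1}$, $$-\phi_{tt}+\phi_{xx}+\phi\,\bigl(|\phi_x|^2-|\phi_t|^2\bigr)=0,\qquad \phi(0)=f,\qquad \phi_t(0)=0,$$ has a unique smooth global solution $\phi:\mathbf R^{1+1}\to\mathbf R^m$; it takes values in $S^{m-1}$. For every time $T$ the function $g_T=\phi(T)-e_1$ is integrable on $\mathbf R$ and the norms $$\|\phi(T)\|_{\dot H^{1/2}}:=\Bigl(\int_{\mathbf R}|\xi|\,|\hat g_T(\xi)|^2\,d\xi\Bigr)^{1/2},\qquad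 \|\phi(T)\|_{\dot B^{1/2,1}_2}:=\sum_{j\in\mathbf Z}2^{j/2}\Bigl(\int_{2^j\le|\xi|<2^{j+1}}|\hat g_T(\xi)|^2\,d\xi\Bigr)^{1/2},$$ where $\hat g(\xi)=\int_{\mathbf R} g(x)e^{-2\pi i x\xi}\,dx$, are finite. As $T\to\infty$, $$\|\phi(T)\|_{\dot H^{1/2}}\to\infty\qquad\text{and}\qquad \|\phi(T)\|_{\dot B^{1/2,1}_2}\to\infty .$$ More precisely, for some constants $0<c\le K$ (depending on $f$) and all sufficiently large $T$, $$c\,(\log T)^{1/2}\le\|\phi(T)\|_{\dot H^{1/2}}\le K\,(\log T)^{1/2},\qquad c\,\log T\le\|\phi(T)\|_{\dot B^{1/2,1}_2}\le K\,\log T .$$ -/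

import Mathlib

open Filter Topology MeasureTheory
open scoped FourierTransform ContDiff ENNReal

noncomputable section

/-- The first standard basis vector `e₁` of `ℝᵐ`, for `m > 0`. -/
def stdE1 (m : ℕ) (hm : 0 < m) : EuclideanSpace ℝ (Fin m) :=
  EuclideanSpace.single (⟨0, hm⟩ : Fin m) (1 : ℝ)

/-- `φ : ℝ × ℝ → ℝᵐ`, written `φ t x`, is a smooth global solution of the Cauchy problem
`□φ + φ (∂_μ φ · ∂^μ φ) = 0`, `φ(0) = f`, `φ_t(0) = 0`, on Minkowski space `ℝ^{1+1}` with
metric `diag (-1, 1)`: thus `□ = -∂_t² + ∂_x²` and `∂_μ φ · ∂^μ φ = |φ_x|² - |φ_t|²`. -/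
structure IsSmoothWaveMapSolution {m : ℕ} (f : ℝ → EuclideanSpace ℝ (Fin m))
    (φ : ℝ → ℝ → EuclideanSpace ℝ (Fin m)) : Prop where
  smooth : ContDiff ℝ ∞ (fun p : ℝ × ℝ => φ p.1 p.2)
  equation : ∀ t x : ℝ,
    -iteratedDeriv 2 (fun s => φ s x) t + iteratedDeriv 2 (fun y => φ t y) x
      + (‖deriv (fun y => φ t y) x‖ ^ 2 - ‖deriv (fun s => φ s x) t‖ ^ 2) • φ t x = 0
  initial_position : ∀ x : ℝ, φ 0 x = f x
  initial_velocity : ∀ x : ℝ, deriv (fun s => φ s x) 0 = 0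

/-- `|ĝ(ξ)|²` for an integrable `g : ℝ → ℝᵐ`, where
`ĝ(ξ) = ∫ g(x) e^{-2πixξ} dx ∈ ℂᵐ` is computed coordinatewise. -/
def fourierNormSq {m : ℕ} (g : ℝ → EuclideanSpace ℝ (Fin m)) (ξ : ℝ) : ℝ :=
  ∑ i : Fin m, ‖𝓕 (fun x : ℝ => ((g x i : ℝ) : ℂ)) ξ‖ ^ 2

/-- The homogeneous Sobolev norm `‖g‖_{Ḣˢ} = (∫ |ξ|^{2s} |ĝ(ξ)|² dξ)^{1/2}` of an integrable
function, with values in `[0, ∞]`. -/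
def homSobolevNorm {m : ℕ} (s : ℝ) (g : ℝ → EuclideanSpace ℝ (Fin m)) : ℝ≥0∞ :=
  (∫⁻ ξ : ℝ, ENNReal.ofReal (|ξ| ^ (2 * s) * fourierNormSq g ξ)) ^ (1 / 2 : ℝ)

/-- The homogeneous Besov norm
`‖g‖_{Ḃ^{s,1}_2} = ∑_{j ∈ ℤ} 2^{js} (∫_{2^j ≤ |ξ| < 2^{j+1}} |ĝ(ξ)|² dξ)^{1/2}` of an integrable
function, with values in `[0, ∞]`. -/
def homBesovNorm {m : ℕ} (s : ℝ) (g : ℝ → EuclideanSpace ℝ (Fin m)) : ℝ≥0∞ :=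
  ∑' j : ℤ, ENNReal.ofReal ((2 : ℝ) ^ ((j : ℝ) * s)) *
    (∫⁻ ξ in {ξ : ℝ | (2 : ℝ) ^ j ≤ |ξ| ∧ |ξ| < (2 : ℝ) ^ (j + 1)},
      ENNReal.ofReal (fourierNormSq g ξ)) ^ (1 / 2 : ℝ)

end

/-!
The solution is explicit. The rotationally symmetric map
`(cos h(t), sin h(t) cos x, sin h(t) sin x)` into the sphere is a wave map as soon as `h` swings
like a pendulum, `h'' = -sin h cos h`, and wave maps from `ℝ^{1+1}` remain wave maps when a function
`χ` is applied to both null coordinates `x + t` and `x - t`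
(`isSmoothWaveMapSolution_pendulumWave`). Let `χ` be a smooth step from `0` to `2π` that is constant
off `[-C, C]`, and release the pendulum from rest. The initial data then traverse a circle of
latitude exactly once. The frame is tilted so that the circle starts and ends at `e₁`, and its
radius `k` is at most `ε exp (-1/C)`, which absorbs the powers of `1/C` coming from the derivatives
of `χ`.

For `t ≥ C` the wave consists of a left-moving and a right-moving profile
(`pendulumWave_eq_profiles`), with `e₁` outside of them and a constant state `p`, read off from the
pendulum at time `π`, between them. The linearized pendulum would be at its opposite turning point
at time `π`, and `p` would be `e₁`. The period of the pendulum is strictly longer, so `p ≠ e₁`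
(`pendulumMap_pi_ne`). Here the dimension enters: the circle of latitude is not a geodesic.

Hence `φ(T) - e₁` is a mollified indicator function of `[-T, T]` times `p - e₁`, and its Fourier
transform has size `|sin (2πTξ)| / |ξ|` for `|ξ| ≤ 1`, with fast decay beyond
(`exists_le_fourier_travellingPair`, `exists_fourier_decay_travellingPair`). Each of the about
`log₂ T` dyadic shells between the frequencies `1 / T` and `1` contributes a quantity of order `1`
to `∑ β_j` and to `∑ β_j²`, where `β_j² = 2^j ∫_{2^j ≤ |ξ| < 2^(j+1)} |ĝ|²`, and the other shells
contribute `O(1)` in total. These sums are the Besov norm and, up to a factor, the squared Sobolev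
norm (`isTheta_norms_of_separating_profiles`).

Uniqueness (`IsSmoothWaveMapSolution.unique`) does not presuppose values in the sphere. The null
derivatives of the difference of two solutions are integrated along characteristics in a backward
light cone, and iterating the resulting inequality gives the bounds `2 M (L t)ⁿ / n!` for all `n`.
-/

noncomputable section

/-! ### The pendulum phase -/

/-- The speed `√(1 - k² sin² s)` of the phase of a pendulum of modulus `k`: if
`ψ' = pendulumSpeed k ψ` then `h = arcsin (k sin ψ)` solves `h'' = -sin h cos h`, and `cos h = ψ'`.
-/
def pendulumSpeed (k s : ℝ) : ℝ := √(1 - k ^ 2 * Real.sin s ^ 2)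

lemma pendulumSpeed_radicand_pos {k : ℝ} (hk0 : 0 < k) (hk1 : k < 1) (s : ℝ) :
    0 < 1 - k ^ 2 * Real.sin s ^ 2 := by
  have h1 := Real.sin_sq_le_one s
  have h2 : k ^ 2 < 1 := by nlinarith
  nlinarith [sq_nonneg k]

lemma pendulumSpeed_pos {k : ℝ} (hk0 : 0 < k) (hk1 : k < 1) (s : ℝ) : 0 < pendulumSpeed k s :=
  Real.sqrt_pos.2 (pendulumSpeed_radicand_pos hk0 hk1 s)

lemma pendulumSpeed_sq {k : ℝ} (hk0 : 0 < k) (hk1 : k < 1) (s : ℝ) :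
    pendulumSpeed k s ^ 2 = 1 - k ^ 2 * Real.sin s ^ 2 :=
  Real.sq_sqrt (pendulumSpeed_radicand_pos hk0 hk1 s).le

lemma pendulumSpeed_le_one (k s : ℝ) : pendulumSpeed k s ≤ 1 := by
  refine Real.sqrt_le_one.2 ?_
  nlinarith [mul_nonneg (sq_nonneg k) (sq_nonneg (Real.sin s))]

lemma contDiff_pendulumSpeed {k : ℝ} (hk0 : 0 < k) (hk1 : k < 1) {n : ℕ∞ω} :
    ContDiff ℝ n (pendulumSpeed k) := by
  unfold pendulumSpeed
  exact ContDiff.sqrt (by fun_prop) fun s => (pendulumSpeed_radicand_pos hk0 hk1 s).ne'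

lemma hasDerivAt_pendulumSpeed {k : ℝ} (hk0 : 0 < k) (hk1 : k < 1) (s : ℝ) :
    HasDerivAt (pendulumSpeed k)
      (-(k ^ 2 * Real.sin s * Real.cos s) / pendulumSpeed k s) s := by
  have h := ((((Real.hasDerivAt_sin s).pow 2).const_mul (k ^ 2)).const_sub 1).sqrt
    (pendulumSpeed_radicand_pos hk0 hk1 s).ne'
  have hp := (pendulumSpeed_pos hk0 hk1 s).ne'
  refine h.congr_deriv ?_
  simp only [pendulumSpeed] at hp ⊢
  simp only [Pi.pow_apply]
  field_simp
  norm_num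
  ring

/-- The phase of the pendulum released from rest at its turning point: a global solution of
`ψ' = √(1 - k² sin² ψ)` with `ψ 0 = π / 2`. It is the inverse of the elliptic integral
`s ↦ ∫_{π/2}^s dx / √(1 - k² sin² x)`, which is onto since its derivative is at least `1`. -/
theorem exists_pendulum_phase {k : ℝ} (hk0 : 0 < k) (hk1 : k < 1) :
    ∃ ψ : ℝ → ℝ, ψ 0 = Real.pi / 2 ∧ ∀ t, HasDerivAt ψ (pendulumSpeed k (ψ t)) t := by
  have hpos := pendulumSpeed_pos hk0 hk1
  have hcont : Continuous fun s => (pendulumSpeed k s)⁻¹ :=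
    ((contDiff_pendulumSpeed hk0 hk1 (n := 0)).continuous).inv₀ fun s => (hpos s).ne'
  set G : ℝ → ℝ := fun s => ∫ x in (Real.pi / 2)..s, (pendulumSpeed k x)⁻¹ with hG
  have hGd : ∀ s, HasDerivAt G (pendulumSpeed k s)⁻¹ s := fun s =>
    intervalIntegral.integral_hasDerivAt_right (hcont.intervalIntegrable _ _)
      hcont.stronglyMeasurable.stronglyMeasurableAtFilter hcont.continuousAt
  have hmono : StrictMono G := strictMono_of_deriv_pos fun s => by
    rw [(hGd s).deriv]; exact inv_pos.2 (hpos s)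
  have hGc : Continuous G := continuous_iff_continuousAt.2 fun s => (hGd s).continuousAt
  have hsub : Monotone fun s => G s - s := by
    refine monotone_of_deriv_nonneg (fun s => ((hGd s).sub (hasDerivAt_id s)).differentiableAt) ?_
    intro s
    rw [HasDerivAt.deriv (f := fun s => G s - s) ((hGd s).sub (hasDerivAt_id s))]
    have := (one_le_inv₀ (hpos s)).2 (pendulumSpeed_le_one k s)
    linarith
  have htop : Tendsto G atTop atTop := by
    refine tendsto_atTop_mono' _ ?_ (tendsto_atTop_add_const_right _ (G 0 - 0) tendsto_id)
    filter_upwards [eventually_ge_atTop 0] with s hs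
    have := hsub hs
    simp only [id] at *
    linarith
  have hbot : Tendsto G atBot atBot := by
    refine tendsto_atBot_mono' _ ?_ (tendsto_atBot_add_const_right _ (G 0 - 0) tendsto_id)
    filter_upwards [eventually_le_atBot 0] with s hs
    have := hsub hs
    simp only [id] at *
    linarith
  let e := hmono.orderIsoOfSurjective G (hGc.surjective htop hbot)
  have he : ∀ s, e s = G s := fun s => rfl
  refine ⟨e.symm, ?_, fun t => ?_⟩
  · rw [OrderIso.symm_apply_eq, he, hG]; simp
  · have h := HasDerivAt.of_local_left_inverse (f := G) (g := e.symm) (a := t)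
      e.symm.continuous.continuousAt (hGd (e.symm t)) (inv_ne_zero (hpos _).ne')
      (Eventually.of_forall fun y => e.apply_symm_apply y)
    simpa using h

/-- Solutions of an autonomous equation with smooth right-hand side are smooth, by bootstrapping. -/
lemma contDiff_of_autonomous_ode {v ψ : ℝ → ℝ} (hv : ContDiff ℝ ∞ v)
    (hψ : ∀ t, HasDerivAt ψ (v (ψ t)) t) : ContDiff ℝ ∞ ψ := by
  rw [contDiff_infty]
  intro n
  induction n with
  | zero =>
    exact contDiff_zero.2 (continuous_iff_continuousAt.2 fun t => (hψ t).continuousAt)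
  | succ n ih =>
    push_cast
    rw [contDiff_succ_iff_deriv]
    refine ⟨fun t => (hψ t).differentiableAt, by simp, ?_⟩
    have : deriv ψ = fun t => v (ψ t) := funext fun t => (hψ t).deriv
    rw [this]
    exact (hv.of_le (by exact_mod_cast le_top)).comp ih

/-- The pendulum does not reach its opposite turning point by time `π`: its half period exceeds the
half period `π` of the linearized oscillator, because the phase moves with speed at most `1`, and
strictly less than `1` right after its release. -/
lemma neg_one_lt_sin_pendulum_phase_pi {k : ℝ} (hk0 : 0 < k) (hk1 : k < 1) {ψ : ℝ → ℝ}
    (h0 : ψ 0 = Real.pi / 2) (hψ : ∀ t, HasDerivAt ψ (pendulumSpeed k (ψ t)) t) :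
    -1 < Real.sin (ψ Real.pi) := by
  have hpi := Real.pi_pos
  have hmono : StrictMono ψ := strictMono_of_deriv_pos fun s => by
    rw [(hψ s).deriv]; exact pendulumSpeed_pos hk0 hk1 _
  have hanti : Monotone fun s => s - ψ s := by
    refine monotone_of_deriv_nonneg (fun s => ((hasDerivAt_id s).sub (hψ s)).differentiableAt) ?_
    intro s
    rw [HasDerivAt.deriv (f := fun s => s - ψ s) ((hasDerivAt_id s).sub (hψ s))]
    linarith [pendulumSpeed_le_one k (ψ s)]
  obtain ⟨c, hc, hcd⟩ := exists_hasDerivAt_eq_slope ψ _ (show (0 : ℝ) < Real.pi / 4 by linarith)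
    (continuous_iff_continuousAt.2 fun t => (hψ t).continuousAt).continuousOn (fun t _ => hψ t)
  have hlow : Real.pi / 2 < ψ c := h0 ▸ hmono hc.1
  have hupp : ψ c ≤ Real.pi / 2 + c := by
    have := hanti hc.1.le
    simp only [h0] at this
    linarith
  have hsin : 0 < Real.sin (ψ c) := Real.sin_pos_of_pos_of_lt_pi (by linarith) (by linarith [hc.2])
  have hlt : pendulumSpeed k (ψ c) < 1 := by
    have := pendulumSpeed_sq hk0 hk1 (ψ c)
    have : 0 < k ^ 2 * Real.sin (ψ c) ^ 2 := by positivity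
    nlinarith
  rw [hcd, sub_zero, div_lt_one (by linarith), h0] at hlt
  have h2 := hanti (show Real.pi / 4 ≤ Real.pi by linarith)
  simp only at h2
  have h3 : Real.pi / 2 < ψ Real.pi := h0 ▸ hmono hpi
  have h4 : Real.sin (ψ Real.pi) = Real.cos (ψ Real.pi - Real.pi / 2) := by
    rw [Real.cos_sub_pi_div_two]
  rw [h4, ← Real.cos_pi]
  exact Real.cos_lt_cos_of_nonneg_of_le_pi (by linarith) le_rfl (by linarith)

/-- The time coordinate of the conformal change of variables of `ℝ^{1+1}` that applies `χ` to both
null coordinates `x + t` and `x - t`. -/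
def conformalTime (χ : ℝ → ℝ) (t x : ℝ) : ℝ := (χ (x + t) - χ (x - t)) / 2

/-- The space coordinate of the conformal change of variables that applies `χ` to both null
coordinates `x + t` and `x - t`. If `χ'` is the derivative of `χ`, then `conformalSpace χ'` is the
space derivative of `conformalSpace χ` and the time derivative of `conformalTime χ`, and
`conformalTime χ'` is the time derivative of `conformalSpace χ` and the space derivative of
`conformalTime χ`. -/
def conformalSpace (χ : ℝ → ℝ) (t x : ℝ) : ℝ := (χ (x + t) + χ (x - t)) / 2

lemma hasDerivAt_conformalTime_time {χ χ' : ℝ → ℝ}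
    (hχ : ∀ s, HasDerivAt χ (χ' s) s) (t x : ℝ) :
    HasDerivAt (fun s => conformalTime χ s x) (conformalSpace χ' t x) t := by
  have h1 := (hχ (x + t)).comp_const_add x t
  have h2 := (hχ (x - t)).comp_const_sub x t
  exact ((h1.sub h2).div_const 2).congr_deriv (by simp [conformalSpace])

lemma hasDerivAt_conformalSpace_time {χ χ' : ℝ → ℝ}
    (hχ : ∀ s, HasDerivAt χ (χ' s) s) (t x : ℝ) :
    HasDerivAt (fun s => conformalSpace χ s x) (conformalTime χ' t x) t := by
  have h1 := (hχ (x + t)).comp_const_add x t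
  have h2 := (hχ (x - t)).comp_const_sub x t
  exact ((h1.add h2).div_const 2).congr_deriv (by simp [conformalTime, sub_eq_add_neg])

lemma hasDerivAt_conformalTime_space {χ χ' : ℝ → ℝ}
    (hχ : ∀ s, HasDerivAt χ (χ' s) s) (t x : ℝ) :
    HasDerivAt (fun z => conformalTime χ t z) (conformalTime χ' t x) x := by
  have h1 := (hχ (x + t)).comp_add_const x t
  have h2 := (hχ (x - t)).comp_sub_const x t
  exact (h1.sub h2).div_const 2

lemma hasDerivAt_conformalSpace_space {χ χ' : ℝ → ℝ}
    (hχ : ∀ s, HasDerivAt χ (χ' s) s) (t x : ℝ) :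
    HasDerivAt (fun z => conformalSpace χ t z) (conformalSpace χ' t x) x := by
  have h1 := (hχ (x + t)).comp_add_const x t
  have h2 := (hχ (x - t)).comp_sub_const x t
  exact (h1.add h2).div_const 2

/-! ### The pendulum wave map -/

/-- The function `A(τ) B(y)` in the coordinates `τ = conformalTime χ t x`,
`y = conformalSpace χ t x`. -/
def separatedWave (χ A B : ℝ → ℝ) (t x : ℝ) : ℝ :=
  A (conformalTime χ t x) * B (conformalSpace χ t x)

lemma hasDerivAt_separatedWave_time {χ χ' A A' B B' : ℝ → ℝ}
    (hχ : ∀ s, HasDerivAt χ (χ' s) s) (hA : ∀ s, HasDerivAt A (A' s) s)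
    (hB : ∀ s, HasDerivAt B (B' s) s) (t x : ℝ) :
    HasDerivAt (fun s => separatedWave χ A B s x)
      (conformalSpace χ' t x * separatedWave χ A' B t x
        + conformalTime χ' t x * separatedWave χ A B' t x) t := by
  have h1 := HasDerivAt.comp t (hA _) (hasDerivAt_conformalTime_time hχ t x)
  have h2 := HasDerivAt.comp t (hB _) (hasDerivAt_conformalSpace_time hχ t x)
  exact (h1.mul h2).congr_deriv (by simp only [separatedWave, Function.comp_apply]; ring)

lemma hasDerivAt_separatedWave_space {χ χ' A A' B B' : ℝ → ℝ}
    (hχ : ∀ s, HasDerivAt χ (χ' s) s) (hA : ∀ s, HasDerivAt A (A' s) s)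
    (hB : ∀ s, HasDerivAt B (B' s) s) (t x : ℝ) :
    HasDerivAt (fun z => separatedWave χ A B t z)
      (conformalTime χ' t x * separatedWave χ A' B t x
        + conformalSpace χ' t x * separatedWave χ A B' t x) x := by
  have h1 := HasDerivAt.comp x (hA _) (hasDerivAt_conformalTime_space hχ t x)
  have h2 := HasDerivAt.comp x (hB _) (hasDerivAt_conformalSpace_space hχ t x)
  exact (h1.mul h2).congr_deriv (by simp only [separatedWave, Function.comp_apply]; ring)

/-- The time derivative of `separatedWave χ A B`, where `χ'`, `A'`, `B'` are the derivatives. -/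
def separatedWaveTime (χ χ' A A' B B' : ℝ → ℝ) (t x : ℝ) : ℝ :=
  conformalSpace χ' t x * separatedWave χ A' B t x
    + conformalTime χ' t x * separatedWave χ A B' t x

/-- The space derivative of `separatedWave χ A B`, where `χ'`, `A'`, `B'` are the derivatives. -/
def separatedWaveSpace (χ χ' A A' B B' : ℝ → ℝ) (t x : ℝ) : ℝ :=
  conformalTime χ' t x * separatedWave χ A' B t x
    + conformalSpace χ' t x * separatedWave χ A B' t x

/-- Conformal covariance of the wave operator: `∂_x² - ∂_t²` of `A(τ) B(y)` is `A B'' - A'' B` times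
the conformal factor. -/
lemma exists_hasDerivAt_separatedWave {χ χ' χ'' A A' A'' B B' B'' : ℝ → ℝ}
    (hχ : ∀ s, HasDerivAt χ (χ' s) s) (hχ' : ∀ s, HasDerivAt χ' (χ'' s) s)
    (hA : ∀ s, HasDerivAt A (A' s) s) (hA' : ∀ s, HasDerivAt A' (A'' s) s)
    (hB : ∀ s, HasDerivAt B (B' s) s) (hB' : ∀ s, HasDerivAt B' (B'' s) s) (t x : ℝ) :
    ∃ p q : ℝ, HasDerivAt (fun s => separatedWaveTime χ χ' A A' B B' s x) p t ∧
      HasDerivAt (fun z => separatedWaveSpace χ χ' A A' B B' t z) q x ∧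
      q - p = (conformalSpace χ' t x ^ 2 - conformalTime χ' t x ^ 2) *
        (separatedWave χ A B'' t x - separatedWave χ A'' B t x) := by
  refine ⟨_, _,
    ((hasDerivAt_conformalSpace_time hχ' t x).mul (hasDerivAt_separatedWave_time hχ hA' hB t x)).add
    ((hasDerivAt_conformalTime_time hχ' t x).mul (hasDerivAt_separatedWave_time hχ hA hB' t x)),
    ((hasDerivAt_conformalTime_space hχ' t x).mul
      (hasDerivAt_separatedWave_space hχ hA' hB t x)).add
    ((hasDerivAt_conformalSpace_space hχ' t x).mul
      (hasDerivAt_separatedWave_space hχ hA hB' t x)), ?_⟩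
  ring

/-- The vector with coordinates `x`, `y`, `z` in the frame `a`. -/
def frameSum {E : Type*} [AddCommGroup E] [Module ℝ E] (a : Fin 3 → E) (x y z : ℝ) : E :=
  x • a 0 + y • a 1 + z • a 2

lemma norm_frameSum_sq {E : Type*} [NormedAddCommGroup E] [InnerProductSpace ℝ E] {a : Fin 3 → E}
    (ha : Orthonormal ℝ a) (x y z : ℝ) : ‖frameSum a x y z‖ ^ 2 = x ^ 2 + y ^ 2 + z ^ 2 := by
  have h := ha.inner_sum (fun i => ![x, y, z] i) (fun i => ![x, y, z] i) Finset.univ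
  simp only [Fin.sum_univ_three, real_inner_self_eq_norm_sq] at h
  simp only [frameSum]
  refine h.trans ?_
  change x * x + y * y + z * z = _
  ring

lemma hasDerivAt_frameSum {E : Type*} [NormedAddCommGroup E] [NormedSpace ℝ E] (a : Fin 3 → E)
    {f g h : ℝ → ℝ} {f' g' h' s : ℝ} (hf : HasDerivAt f f' s) (hg : HasDerivAt g g' s)
    (hh : HasDerivAt h h' s) :
    HasDerivAt (fun s => frameSum a (f s) (g s) (h s)) (frameSum a f' g' h') s :=
  ((hf.smul_const _).add (hg.smul_const _)).add (hh.smul_const _)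

/-- The rotationally symmetric wave map `(cos h(s), sin h(s) cos y, sin h(s) sin y)` in the frame
`a`, where the polar angle `h = arcsin (k sin ψ)` swings like a pendulum. -/
def pendulumMap {E : Type*} [AddCommGroup E] [Module ℝ E] (a : Fin 3 → E) (k : ℝ) (ψ : ℝ → ℝ)
    (s y : ℝ) : E :=
  frameSum a (pendulumSpeed k (ψ s)) (k * Real.sin (ψ s) * Real.cos y)
    (k * Real.sin (ψ s) * Real.sin y)

/-- The pendulum wave map in the conformal coordinates defined by `χ`. -/
def pendulumWave {E : Type*} [AddCommGroup E] [Module ℝ E] (a : Fin 3 → E) (k : ℝ) (ψ χ : ℝ → ℝ)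
    (t x : ℝ) : E :=
  pendulumMap a k ψ (conformalTime χ t x) (conformalSpace χ t x)

lemma contDiff_pendulumMap {E : Type*} [NormedAddCommGroup E] [NormedSpace ℝ E] (a : Fin 3 → E)
    {k : ℝ} (hk0 : 0 < k) (hk1 : k < 1) {ψ : ℝ → ℝ} (hψ : ContDiff ℝ ∞ ψ) :
    ContDiff ℝ ∞ fun p : ℝ × ℝ => pendulumMap a k ψ p.1 p.2 := by
  have h := contDiff_pendulumSpeed hk0 hk1 (n := ∞)
  unfold pendulumMap frameSum
  fun_prop

lemma norm_pendulumMap {E : Type*} [NormedAddCommGroup E] [InnerProductSpace ℝ E] {a : Fin 3 → E}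
    (ha : Orthonormal ℝ a) {k : ℝ} (hk0 : 0 < k) (hk1 : k < 1) (ψ : ℝ → ℝ) (s y : ℝ) :
    ‖pendulumMap a k ψ s y‖ = 1 := by
  have h : ‖pendulumMap a k ψ s y‖ ^ 2 = 1 := by
    rw [pendulumMap, norm_frameSum_sq ha, pendulumSpeed_sq hk0 hk1]
    linear_combination k ^ 2 * Real.sin (ψ s) ^ 2 * Real.sin_sq_add_cos_sq y
  nlinarith [norm_nonneg (pendulumMap a k ψ s y)]

/-- The pendulum wave, with any smooth reparametrization `χ` of the null coordinates, is a wave map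
at rest at time `0`, when it traverses a circle of latitude. -/
theorem isSmoothWaveMapSolution_pendulumWave {m : ℕ} {a : Fin 3 → EuclideanSpace ℝ (Fin m)}
    (ha : Orthonormal ℝ a) {k : ℝ} (hk0 : 0 < k) (hk1 : k < 1) {ψ χ : ℝ → ℝ}
    (hψ : ∀ t, HasDerivAt ψ (pendulumSpeed k (ψ t)) t) (hψ0 : ψ 0 = Real.pi / 2)
    (hχ : ContDiff ℝ ∞ χ) :
    IsSmoothWaveMapSolution (fun x => pendulumMap a k ψ 0 (χ x)) (pendulumWave a k ψ χ) := by
  have hspeed := pendulumSpeed_pos hk0 hk1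
  have hχ2 : ContDiff ℝ 2 χ := contDiff_infty.1 hχ 2
  have hχ1 : ContDiff ℝ 1 (deriv χ) := (contDiff_succ_iff_deriv (n := 1).1 hχ2).2.2
  have dχ : ∀ s, HasDerivAt χ (deriv χ s) s := fun s =>
    (hχ2.differentiable (by norm_num) s).hasDerivAt
  have dχ' : ∀ s, HasDerivAt (deriv χ) (deriv (deriv χ) s) s := fun s =>
    (hχ1.differentiable (by norm_num) s).hasDerivAt
  -- the axial component and its first two derivatives
  set A : ℝ → ℝ := fun s => pendulumSpeed k (ψ s)
  set A' : ℝ → ℝ := fun s => -(k ^ 2 * Real.sin (ψ s) * Real.cos (ψ s))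
  set A'' : ℝ → ℝ := fun s => (k ^ 2 * Real.sin (ψ s) ^ 2 - k ^ 2 * Real.cos (ψ s) ^ 2) * A s
  have dA : ∀ s, HasDerivAt A (A' s) s := fun s => by
    refine ((hasDerivAt_pendulumSpeed hk0 hk1 (ψ s)).comp s (hψ s)).congr_deriv ?_
    rw [div_mul_cancel₀ _ (hspeed _).ne']
  have dsin : ∀ s, HasDerivAt (fun s => Real.sin (ψ s)) (Real.cos (ψ s) * A s) s :=
    fun s => (hψ s).sin
  have dcos : ∀ s, HasDerivAt (fun s => Real.cos (ψ s)) (-Real.sin (ψ s) * A s) s :=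
    fun s => (hψ s).cos
  have dA' : ∀ s, HasDerivAt A' (A'' s) s := fun s => by
    refine (((dsin s).const_mul (k ^ 2)).mul (dcos s)).neg.congr_deriv ?_
    simp only [A'']; ring
  -- the radius of the circle of latitude and its first two derivatives
  set Q : ℝ → ℝ := fun s => k * Real.sin (ψ s)
  set Q' : ℝ → ℝ := fun s => k * (Real.cos (ψ s) * A s)
  set Q'' : ℝ → ℝ := fun s => k * (-Real.sin (ψ s) * A s * A s + Real.cos (ψ s) * A' s)
  have dQ : ∀ s, HasDerivAt Q (Q' s) s := fun s => (dsin s).const_mul k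
  have dQ' : ∀ s, HasDerivAt Q' (Q'' s) s := fun s => ((dcos s).mul (dA s)).const_mul k
  have d1 : ∀ s : ℝ, HasDerivAt (fun _ : ℝ => (1 : ℝ)) ((fun _ => 0) s) s :=
    fun s => hasDerivAt_const s 1
  have d0 : ∀ s : ℝ, HasDerivAt (fun _ : ℝ => (0 : ℝ)) ((fun _ => 0) s) s :=
    fun s => hasDerivAt_const s 0
  have dc := Real.hasDerivAt_cos
  have ds := Real.hasDerivAt_sin
  have dc' : ∀ s, HasDerivAt (fun s => -Real.sin s) ((fun s => -Real.cos s) s) s :=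
    fun s => (ds s).neg
  have hφ : pendulumWave a k ψ χ = fun t x => frameSum a (separatedWave χ A (fun _ => 1) t x)
      (separatedWave χ Q Real.cos t x) (separatedWave χ Q Real.sin t x) := by
    funext t x
    simp [pendulumWave, pendulumMap, separatedWave, A, Q]
  have ht : ∀ t x, HasDerivAt (fun s => pendulumWave a k ψ χ s x)
      (frameSum a (separatedWaveTime χ (deriv χ) A A' (fun _ => 1) (fun _ => 0) t x)
        (separatedWaveTime χ (deriv χ) Q Q' Real.cos (fun s => -Real.sin s) t x)
        (separatedWaveTime χ (deriv χ) Q Q' Real.sin Real.cos t x)) t := fun t x => by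
    rw [hφ]
    exact hasDerivAt_frameSum a (hasDerivAt_separatedWave_time dχ dA d1 t x)
      (hasDerivAt_separatedWave_time dχ dQ dc t x) (hasDerivAt_separatedWave_time dχ dQ ds t x)
  have hx : ∀ t x, HasDerivAt (fun z => pendulumWave a k ψ χ t z)
      (frameSum a (separatedWaveSpace χ (deriv χ) A A' (fun _ => 1) (fun _ => 0) t x)
        (separatedWaveSpace χ (deriv χ) Q Q' Real.cos (fun s => -Real.sin s) t x)
        (separatedWaveSpace χ (deriv χ) Q Q' Real.sin Real.cos t x)) x := fun t x => by
    rw [hφ]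
    exact hasDerivAt_frameSum a (hasDerivAt_separatedWave_space dχ dA d1 t x)
      (hasDerivAt_separatedWave_space dχ dQ dc t x) (hasDerivAt_separatedWave_space dχ dQ ds t x)
  refine ⟨?_, fun t x => ?_, fun x => ?_, fun x => ?_⟩
  · have hmap := contDiff_pendulumMap a hk0 hk1
      (contDiff_of_autonomous_ode (contDiff_pendulumSpeed hk0 hk1) hψ)
    exact hmap.comp (f := fun p : ℝ × ℝ => (conformalTime χ p.1 p.2, conformalSpace χ p.1 p.2))
      (by unfold conformalTime conformalSpace; fun_prop)
  · obtain ⟨p1, q1, hp1, hq1, e1⟩ := exists_hasDerivAt_separatedWave dχ dχ' dA dA' d1 d0 t x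
    obtain ⟨p2, q2, hp2, hq2, e2⟩ := exists_hasDerivAt_separatedWave dχ dχ' dQ dQ' dc dc' t x
    obtain ⟨p3, q3, hp3, hq3, e3⟩ := exists_hasDerivAt_separatedWave dχ dχ' dQ dQ' ds dc t x
    rw [iteratedDeriv_succ, iteratedDeriv_one, iteratedDeriv_succ, iteratedDeriv_one]
    rw [(ht t x).deriv, (hx t x).deriv, norm_frameSum_sq ha, norm_frameSum_sq ha]
    rw [show deriv (fun s => pendulumWave a k ψ χ s x) = _ from funext fun s => (ht s x).deriv,
      show deriv (fun z => pendulumWave a k ψ χ t z) = _ from funext fun z => (hx t z).deriv]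
    rw [(hasDerivAt_frameSum a hp1 hp2 hp3).deriv, (hasDerivAt_frameSum a hq1 hq2 hq3).deriv, hφ]
    have hA2 : ∀ s, A s ^ 2 = 1 - k ^ 2 * Real.sin (ψ s) ^ 2 := fun s =>
      pendulumSpeed_sq hk0 hk1 (ψ s)
    have key : ∀ r z1 z2 z3 : ℝ, q1 - p1 + r * z1 = 0 → q2 - p2 + r * z2 = 0 →
        q3 - p3 + r * z3 = 0 →
        -frameSum a p1 p2 p3 + frameSum a q1 q2 q3 + r • frameSum a z1 z2 z3 = 0 := by
      intro r z1 z2 z3 h1 h2 h3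
      have : -frameSum a p1 p2 p3 + frameSum a q1 q2 q3 + r • frameSum a z1 z2 z3 =
          (q1 - p1 + r * z1) • a 0 + (q2 - p2 + r * z2) • a 1 + (q3 - p3 + r * z3) • a 2 := by
        simp only [frameSum]; module
      rw [this, h1, h2, h3]; simp
    -- the wave operator and the null form scale by the same conformal factor
    have hnull : separatedWaveSpace χ (deriv χ) A A' (fun _ => 1) (fun _ => 0) t x ^ 2
          + separatedWaveSpace χ (deriv χ) Q Q' Real.cos (fun s => -Real.sin s) t x ^ 2
          + separatedWaveSpace χ (deriv χ) Q Q' Real.sin Real.cos t x ^ 2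
        - (separatedWaveTime χ (deriv χ) A A' (fun _ => 1) (fun _ => 0) t x ^ 2
          + separatedWaveTime χ (deriv χ) Q Q' Real.cos (fun s => -Real.sin s) t x ^ 2
          + separatedWaveTime χ (deriv χ) Q Q' Real.sin Real.cos t x ^ 2)
        = (conformalSpace (deriv χ) t x ^ 2 - conformalTime (deriv χ) t x ^ 2) *
          (k ^ 2 * Real.sin (ψ (conformalTime χ t x)) ^ 2
            - k ^ 2 * Real.cos (ψ (conformalTime χ t x)) ^ 2) := by
      simp only [separatedWaveSpace, separatedWaveTime, separatedWave, Q, Q', A']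
      set τ := conformalTime χ t x
      set y := conformalSpace χ t x
      set α := conformalSpace (deriv χ) t x
      set β := conformalTime (deriv χ) t x
      have h1 := Real.sin_sq_add_cos_sq y
      have h3 := hA2 τ
      have h4 : (α * (k * (Real.cos (ψ τ) * A τ))) ^ 2 =
        α ^ 2 * k ^ 2 * Real.cos (ψ τ) ^ 2 * A τ ^ 2 := by ring
      have hy : Real.sin y ^ 2 = 1 - Real.cos y ^ 2 := by linarith
      ring_nf
      rw [hy, h3]
      ring
    rw [hnull]
    refine key _ _ _ _ ?_ ?_ ?_
    · rw [e1]; simp only [separatedWave, A'']; ring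
    · rw [e2]; simp only [separatedWave, Q'', Q, A']
      linear_combination (conformalSpace (deriv χ) t x ^ 2 - conformalTime (deriv χ) t x ^ 2) * k *
        Real.sin (ψ (conformalTime χ t x)) * Real.cos (conformalSpace χ t x) *
          hA2 (conformalTime χ t x)
    · rw [e3]; simp only [separatedWave, Q'', Q, A']
      linear_combination (conformalSpace (deriv χ) t x ^ 2 - conformalTime (deriv χ) t x ^ 2) * k *
        Real.sin (ψ (conformalTime χ t x)) * Real.sin (conformalSpace χ t x) *
          hA2 (conformalTime χ t x)
  · simp [pendulumWave, conformalTime, conformalSpace]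
  · rw [(ht 0 x).deriv]
    have : Real.cos (ψ 0) = 0 := by rw [hψ0, Real.cos_pi_div_two]
    simp [separatedWaveTime, separatedWave, conformalTime, A', Q', this, frameSum]

/-! ### Uniqueness for the Cauchy problem -/

/-- The part in `{t ≥ 0}` of the backward light cone with apex `(R, x₀)`. -/
def backwardCone (R x₀ : ℝ) : Set (ℝ × ℝ) := {p | 0 ≤ p.1 ∧ |p.2 - x₀| ≤ R - p.1}

/-- One step of the iteration for uniqueness: integrate along the lines of velocity `a` from the
initial line, where `G` vanishes. -/
lemma norm_le_of_norm_fderiv_le_on_backwardCone {E : Type*} [NormedAddCommGroup E]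
    [NormedSpace ℝ E] {G : ℝ × ℝ → E} (hG : Differentiable ℝ G) (hG0 : ∀ x, G (0, x) = 0)
    {R x₀ a K L : ℝ} {n : ℕ} (ha : |a| ≤ 1)
    (hbound : ∀ p ∈ backwardCone R x₀,
      ‖fderiv ℝ G p (1, a)‖ ≤ L * (K * (L * p.1) ^ n / n.factorial)) :
    ∀ p ∈ backwardCone R x₀, ‖G p‖ ≤ K * (L * p.1) ^ (n + 1) / (n + 1).factorial := by
  rintro ⟨t, x⟩ ⟨ht, hx⟩
  simp only at ht hx
  let γ : ℝ → ℝ × ℝ := fun s => (s, x + a * (s - t))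
  have hγ : ∀ s, HasDerivAt γ (1, a) s := fun s => by
    have h := (((hasDerivAt_id s).sub_const t).const_mul a).const_add x
    exact ((hasDerivAt_id s).prodMk h).congr_deriv (by simp)
  have hGγ : ∀ s, HasDerivAt (fun s => G (γ s)) (fderiv ℝ G (γ s) (1, a)) s := fun s =>
    (hG (γ s)).hasFDerivAt.comp_hasDerivAt s (hγ s)
  have hB : ∀ s, HasDerivAt (fun s => K * (L * s) ^ (n + 1) / (n + 1).factorial)
      (L * (K * (L * s) ^ n / n.factorial)) s := fun s => by
    have h := ((((hasDerivAt_id s).const_mul L).pow (n + 1)).const_mul K).div_const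
      ((n + 1).factorial : ℝ)
    refine h.congr_deriv ?_
    rw [Nat.factorial_succ]
    have : (n.factorial : ℝ) ≠ 0 := by positivity
    have : (n : ℝ) + 1 ≠ 0 := by positivity
    push_cast
    simp only [id]
    field_simp
  have hmain := image_norm_le_of_norm_deriv_right_le_deriv_boundary (a := 0) (b := t)
    (fun s _ => (hGγ s).continuousAt.continuousWithinAt)
    (fun s _ => (hGγ s).hasDerivWithinAt)
    (B := fun s => K * (L * s) ^ (n + 1) / (n + 1).factorial)
    (by simp only [γ]; rw [hG0]; simp) hB
    (fun s hs => hbound (γ s) ⟨hs.1, ?_⟩) (Set.right_mem_Icc.2 ht)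
  · simpa [γ] using hmain
  · -- the line of slope `a` stays inside the cone since `|a| ≤ 1`
    have h1 : |a * (s - t)| ≤ t - s := by
      rw [abs_mul, abs_of_nonpos (by linarith [hs.2] : s - t ≤ 0)]
      nlinarith [hs.2]
    have h2 := abs_add_le (x - x₀) (a * (s - t))
    simp only [γ]
    rw [show x + a * (s - t) - x₀ = x - x₀ + a * (s - t) by ring]
    linarith

section solution
variable {m : ℕ}

lemma hasDerivAt_time_of_differentiable {E : Type*} [NormedAddCommGroup E] [NormedSpace ℝ E]
    {F : ℝ × ℝ → E} (hF : Differentiable ℝ F) (t x : ℝ) :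
    HasDerivAt (fun s => F (s, x)) (fderiv ℝ F (t, x) (1, 0)) t :=
  (hF (t, x)).hasFDerivAt.comp_hasDerivAt t ((hasDerivAt_id t).prodMk (hasDerivAt_const t x))

lemma hasDerivAt_space_of_differentiable {E : Type*} [NormedAddCommGroup E] [NormedSpace ℝ E]
    {F : ℝ × ℝ → E} (hF : Differentiable ℝ F) (t x : ℝ) :
    HasDerivAt (fun z => F (t, z)) (fderiv ℝ F (t, x) (0, 1)) x :=
  (hF (t, x)).hasFDerivAt.comp_hasDerivAt x ((hasDerivAt_const x t).prodMk (hasDerivAt_id x))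

lemma contDiff_fderiv_apply_const {E : Type*} [NormedAddCommGroup E] [NormedSpace ℝ E]
    {F : ℝ × ℝ → E} (hF : ContDiff ℝ ∞ F) (v : ℝ × ℝ) :
    ContDiff ℝ ∞ fun p => fderiv ℝ F p v :=
  (hF.fderiv_right (m := ∞) (by simp)).clm_apply contDiff_const

/-- The wave map equation in null directions: with `F` the map, `∂₊ = ∂_t + ∂_x` and
`∂₋ = ∂_t - ∂_x`, it says `∂₋ ∂₊ F = -⟪∂₊ F, ∂₋ F⟫ F`. -/
lemma IsSmoothWaveMapSolution.fderiv_null {f : ℝ → EuclideanSpace ℝ (Fin m)}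
    {φ : ℝ → ℝ → EuclideanSpace ℝ (Fin m)} (h : IsSmoothWaveMapSolution f φ) {F}
    (hF : F = fun p : ℝ × ℝ => φ p.1 p.2) (p : ℝ × ℝ) :
    fderiv ℝ (fun q => fderiv ℝ F q (1, 1)) p (1, -1) =
        -inner ℝ (fderiv ℝ F p (1, 1)) (fderiv ℝ F p (1, -1)) • F p ∧
      fderiv ℝ (fun q => fderiv ℝ F q (1, -1)) p (1, 1) =
        -inner ℝ (fderiv ℝ F p (1, 1)) (fderiv ℝ F p (1, -1)) • F p := by
  have hs : ContDiff ℝ ∞ F := hF ▸ h.smooth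
  have hd : Differentiable ℝ F := hs.differentiable (by simp)
  have hd2 : ∀ v, Differentiable ℝ fun q => fderiv ℝ F q v := fun v =>
    (contDiff_fderiv_apply_const hs v).differentiable (by simp)
  have hdd : DifferentiableAt ℝ (fderiv ℝ F) p :=
    (hs.fderiv_right (m := ∞) (by simp)).differentiable (by simp) p
  have hB : ∀ v w, fderiv ℝ (fun q => fderiv ℝ F q v) p w = fderiv ℝ (fderiv ℝ F) p w v :=
    fun v w => by rw [fderiv_clm_apply hdd (by fun_prop)]; simp
  have hsymm : ∀ v w, fderiv ℝ (fderiv ℝ F) p v w = fderiv ℝ (fderiv ℝ F) p w v :=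
    fun v w => (contDiff_infty.1 hs 2).contDiffAt.isSymmSndFDerivAt (by simp) v w
  have e11 : ((1, 1) : ℝ × ℝ) = (1, 0) + (0, 1) := by simp
  have e1m : ((1, -1) : ℝ × ℝ) = (1, 0) - (0, 1) := by simp
  have heq := h.equation p.1 p.2
  rw [iteratedDeriv_succ, iteratedDeriv_one, iteratedDeriv_succ, iteratedDeriv_one] at heq
  have ht : ∀ t x, HasDerivAt (fun s => φ s x) (fderiv ℝ F (t, x) (1, 0)) t := fun t x => by
    simpa [hF] using hasDerivAt_time_of_differentiable hd t x
  have hx : ∀ t x, HasDerivAt (fun z => φ t z) (fderiv ℝ F (t, x) (0, 1)) x := fun t x => by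
    simpa [hF] using hasDerivAt_space_of_differentiable hd t x
  rw [(ht p.1 p.2).deriv, (hx p.1 p.2).deriv,
    show deriv (fun s => φ s p.2) = _ from funext fun s => (ht s p.2).deriv,
    show deriv (fun z => φ p.1 z) = _ from funext fun z => (hx p.1 z).deriv,
    (hasDerivAt_time_of_differentiable (hd2 (1, 0)) p.1 p.2).deriv,
    (hasDerivAt_space_of_differentiable (hd2 (0, 1)) p.1 p.2).deriv, hB, hB,
    show φ p.1 p.2 = F p by rw [hF]] at heq
  have hinner : -inner ℝ (fderiv ℝ F p (1, 1)) (fderiv ℝ F p (1, -1)) =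
      ‖fderiv ℝ F p (0, 1)‖ ^ 2 - ‖fderiv ℝ F p (1, 0)‖ ^ 2 := by
    rw [e11, e1m, map_add, map_sub, inner_add_left, inner_sub_right, inner_sub_right,
      real_inner_self_eq_norm_sq, real_inner_self_eq_norm_sq, real_inner_comm]
    ring
  have hdiff : fderiv ℝ (fderiv ℝ F) p (1, -1) (1, 1) =
      (‖fderiv ℝ F p (0, 1)‖ ^ 2 - ‖fderiv ℝ F p (1, 0)‖ ^ 2) • F p := by
    rw [← sub_eq_zero, ← neg_eq_zero, ← heq, e11, e1m]
    simp only [map_add, map_sub, _root_.sub_apply, hsymm (0, 1) (1, 0)]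
    abel
  rw [hB, hB, hinner, hsymm (1, 1), hdiff]
  exact ⟨rfl, rfl⟩

/-- The nonlinearity is Lipschitz in the map and its null derivatives, on bounded sets. -/
lemma norm_nullForm_sub_le {E : Type*} [NormedAddCommGroup E] [InnerProductSpace ℝ E]
    {M : ℝ} {p q z p' q' z' : E} (hp : ‖p‖ ≤ M) (hz : ‖z‖ ≤ M)
    (hq' : ‖q'‖ ≤ M) (hp' : ‖p'‖ ≤ M) :
    ‖-inner ℝ p q • z - -inner ℝ p' q' • z'‖ ≤
      M ^ 2 * (‖p - p'‖ + ‖q - q'‖ + ‖z - z'‖) := by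
  have hM : 0 ≤ M := (norm_nonneg _).trans hp
  have e : -inner ℝ p q • z - -inner ℝ p' q' • z' =
      -(inner ℝ p (q - q') • z + inner ℝ (p - p') q' • z + inner ℝ p' q' • (z - z')) := by
    rw [inner_sub_right, inner_sub_left]; module
  rw [e, norm_neg]
  have h1 : ‖inner ℝ p (q - q') • z‖ ≤ M * ‖q - q'‖ * M := by
    rw [norm_smul]
    have := norm_inner_le_norm (𝕜 := ℝ) p (q - q')
    gcongr
    exact this.trans (by gcongr)
  have h2 : ‖inner ℝ (p - p') q' • z‖ ≤ ‖p - p'‖ * M * M := by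
    rw [norm_smul]
    have := norm_inner_le_norm (𝕜 := ℝ) (p - p') q'
    gcongr
    exact this.trans (by gcongr)
  have h3 : ‖inner ℝ p' q' • (z - z')‖ ≤ M * M * ‖z - z'‖ := by
    rw [norm_smul]
    have := norm_inner_le_norm (𝕜 := ℝ) p' q'
    gcongr
    exact this.trans (by gcongr)
  have := norm_add₃_le (a := inner ℝ p (q - q') • z) (b := inner ℝ (p - p') q' • z)
    (c := inner ℝ p' q' • (z - z'))
  linarith

lemma IsSmoothWaveMapSolution.fderiv_initial {f : ℝ → EuclideanSpace ℝ (Fin m)}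
    {φ : ℝ → ℝ → EuclideanSpace ℝ (Fin m)} (h : IsSmoothWaveMapSolution f φ) {F}
    (hF : F = fun p : ℝ × ℝ => φ p.1 p.2) (x : ℝ) (v : ℝ × ℝ) :
    fderiv ℝ F (0, x) v = v.2 • deriv f x := by
  have hs : ContDiff ℝ ∞ F := hF ▸ h.smooth
  have hd : Differentiable ℝ F := hs.differentiable (by simp)
  have h1 := (hasDerivAt_time_of_differentiable hd 0 x).deriv
  have h2 := (hasDerivAt_space_of_differentiable hd 0 x).deriv
  simp only [hF, h.initial_velocity, h.initial_position] at h1 h2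
  have hv : v = v.1 • ((1, 0) : ℝ × ℝ) + v.2 • ((0, 1) : ℝ × ℝ) := by ext <;> simp
  rw [hv, map_add, map_smul, map_smul, hF, ← h1, ← h2]
  simp

/-- Uniqueness for `t ≥ 0`. On the backward cone of a point, the difference of two solutions and its
two null derivatives are at most `2 M (L t)ⁿ / n!` for every `n`, by induction on `n`. -/
lemma IsSmoothWaveMapSolution.eq_of_nonneg {f : ℝ → EuclideanSpace ℝ (Fin m)}
    {φ ψ : ℝ → ℝ → EuclideanSpace ℝ (Fin m)} (hφ : IsSmoothWaveMapSolution f φ)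
    (hψ : IsSmoothWaveMapSolution f ψ) {t : ℝ} (ht : 0 ≤ t) (x : ℝ) : ψ t x = φ t x := by
  obtain ⟨F, hF⟩ : ∃ F, F = fun p : ℝ × ℝ => φ p.1 p.2 := ⟨_, rfl⟩
  obtain ⟨G, hG⟩ : ∃ G, G = fun p : ℝ × ℝ => ψ p.1 p.2 := ⟨_, rfl⟩
  have hFs : ContDiff ℝ ∞ F := hF ▸ hφ.smooth
  have hGs : ContDiff ℝ ∞ G := hG ▸ hψ.smooth
  have hFd : Differentiable ℝ F := hFs.differentiable (by simp)
  have hGd : Differentiable ℝ G := hGs.differentiable (by simp)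
  have hFv : ∀ v, ContDiff ℝ ∞ fun p => fderiv ℝ F p v := contDiff_fderiv_apply_const hFs
  have hGv : ∀ v, ContDiff ℝ ∞ fun p => fderiv ℝ G p v := contDiff_fderiv_apply_const hGs
  have hdF : ∀ v, Differentiable ℝ fun p => fderiv ℝ F p v := fun v =>
    (hFv v).differentiable (by simp)
  have hdG : ∀ v, Differentiable ℝ fun p => fderiv ℝ G p v := fun v =>
    (hGv v).differentiable (by simp)
  obtain ⟨M, hM1, hM⟩ : ∃ M : ℝ, 1 ≤ M ∧ ∀ p ∈ backwardCone t x,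
      ‖F p‖ ≤ M ∧ ‖fderiv ℝ F p (1, 1)‖ ≤ M ∧ ‖fderiv ℝ F p (1, -1)‖ ≤ M ∧
      ‖G p‖ ≤ M ∧ ‖fderiv ℝ G p (1, 1)‖ ≤ M ∧ ‖fderiv ℝ G p (1, -1)‖ ≤ M := by
    have hc : Continuous fun p => ‖F p‖ + ‖fderiv ℝ F p (1, 1)‖ + ‖fderiv ℝ F p (1, -1)‖ +
        ‖G p‖ + ‖fderiv ℝ G p (1, 1)‖ + ‖fderiv ℝ G p (1, -1)‖ := by
      have := hFs.continuous
      have := hGs.continuous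
      have := fun v => (hFv v).continuous
      have := fun v => (hGv v).continuous
      fun_prop
    obtain ⟨M, hM⟩ := ((isCompact_Icc (a := (0 : ℝ)) (b := t)).prod
      (isCompact_Icc (a := x - t) (b := x + t))).exists_bound_of_continuousOn hc.continuousOn
    refine ⟨max 1 M, le_max_left _ _, fun p hp => ?_⟩
    have hpt : p.1 ≤ t := by linarith [abs_nonneg (p.2 - x), hp.2]
    have hpx := abs_le.1 hp.2
    have hp1 := hp.1
    have hb := (Real.le_norm_self _).trans (hM p ⟨⟨hp.1, hpt⟩, by
      constructor <;> linarith [hpx.1, hpx.2]⟩)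
    have hb' := hb.trans (le_max_right 1 M)
    refine ⟨?_, ?_, ?_, ?_, ?_, ?_⟩ <;> refine le_trans ?_ hb' <;>
    · have := norm_nonneg (F p)
      have := norm_nonneg (fderiv ℝ F p (1, 1))
      have := norm_nonneg (fderiv ℝ F p (1, -1))
      have := norm_nonneg (G p)
      have := norm_nonneg (fderiv ℝ G p (1, 1))
      have := norm_nonneg (fderiv ℝ G p (1, -1))
      linarith
  set L : ℝ := 3 * M ^ 2 with hL
  have hL1 : 1 ≤ L := by nlinarith
  have hind : ∀ n : ℕ, ∀ p ∈ backwardCone t x,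
      ‖G p - F p‖ ≤ 2 * M * (L * p.1) ^ n / n.factorial ∧
      ‖fderiv ℝ G p (1, 1) - fderiv ℝ F p (1, 1)‖ ≤ 2 * M * (L * p.1) ^ n / n.factorial ∧
      ‖fderiv ℝ G p (1, -1) - fderiv ℝ F p (1, -1)‖ ≤ 2 * M * (L * p.1) ^ n / n.factorial := by
    intro n
    induction n with
    | zero =>
      intro p hp
      obtain ⟨h1, h2, h3, h4, h5, h6⟩ := hM p hp
      simp only [pow_zero, Nat.factorial_zero, Nat.cast_one, mul_one, div_one]
      refine ⟨?_, ?_, ?_⟩ <;> refine (norm_sub_le _ _).trans ?_ <;> linarith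
    | succ n ih =>
      have hnull : ∀ p ∈ backwardCone t x,
          ‖-inner ℝ (fderiv ℝ G p (1, 1)) (fderiv ℝ G p (1, -1)) • G p -
            -inner ℝ (fderiv ℝ F p (1, 1)) (fderiv ℝ F p (1, -1)) • F p‖ ≤
          L * (2 * M * (L * p.1) ^ n / n.factorial) := by
        intro p hp
        obtain ⟨h1, h2, h3, h4, h5, h6⟩ := hM p hp
        obtain ⟨i1, i2, i3⟩ := ih p hp
        refine (norm_nullForm_sub_le h5 h4 h3 h2).trans ?_
        calc _ ≤ M ^ 2 * (2 * M * (L * p.1) ^ n / n.factorial + 2 * M * (L * p.1) ^ n / n.factorial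
              + 2 * M * (L * p.1) ^ n / n.factorial) := by gcongr
          _ = _ := by rw [hL]; ring
      have b1 := norm_le_of_norm_fderiv_le_on_backwardCone (G := fun p => G p - F p)
        (R := t) (x₀ := x) (a := 0) (K := 2 * M) (L := L) (n := n) (hGd.sub hFd)
        (fun y => by simp [hF, hG, hφ.initial_position, hψ.initial_position]) (by simp)
        (fun p hp => by
          obtain ⟨i1, i2, i3⟩ := ih p hp
          have e : fderiv ℝ (fun p => G p - F p) p (1, 0) =
              (1 / 2 : ℝ) • ((fderiv ℝ G p (1, 1) - fderiv ℝ F p (1, 1)) +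
                (fderiv ℝ G p (1, -1) - fderiv ℝ F p (1, -1))) := by
            rw [fderiv_fun_sub (hGd p) (hFd p), _root_.sub_apply,
              show ((1, 0) : ℝ × ℝ) = (1 / 2 : ℝ) • ((1, 1) + (1, -1)) by ext <;> norm_num,
              map_smul, map_smul, map_add, map_add]
            module
          rw [e, norm_smul, Real.norm_of_nonneg (by norm_num)]
          have h := norm_add_le (fderiv ℝ G p (1, 1) - fderiv ℝ F p (1, 1))
            (fderiv ℝ G p (1, -1) - fderiv ℝ F p (1, -1))
          have h0 := (norm_nonneg _).trans i1
          nlinarith)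
      have b2 := norm_le_of_norm_fderiv_le_on_backwardCone
        (G := fun p => fderiv ℝ G p (1, 1) - fderiv ℝ F p (1, 1))
        (R := t) (x₀ := x) (a := -1) (K := 2 * M) (L := L) (n := n)
        ((hdG (1, 1)).sub (hdF (1, 1)))
        (fun y => by rw [hφ.fderiv_initial hF, hψ.fderiv_initial hG, sub_self]) (by simp)
        (fun p hp => by
          rw [fderiv_fun_sub (hdG _ p) (hdF _ p), _root_.sub_apply,
            (hφ.fderiv_null hF p).1, (hψ.fderiv_null hG p).1]
          exact hnull p hp)
      have b3 := norm_le_of_norm_fderiv_le_on_backwardCone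
        (G := fun p => fderiv ℝ G p (1, -1) - fderiv ℝ F p (1, -1))
        (R := t) (x₀ := x) (a := 1) (K := 2 * M) (L := L) (n := n)
        ((hdG (1, -1)).sub (hdF (1, -1)))
        (fun y => by rw [hφ.fderiv_initial hF, hψ.fderiv_initial hG, sub_self]) (by simp)
        (fun p hp => by
          rw [fderiv_fun_sub (hdG _ p) (hdF _ p), _root_.sub_apply,
            (hφ.fderiv_null hF p).2, (hψ.fderiv_null hG p).2]
          exact hnull p hp)
      exact fun p hp => ⟨b1 p hp, b2 p hp, b3 p hp⟩
  have hlim : Tendsto (fun n : ℕ => 2 * M * (L * t) ^ n / n.factorial) atTop (𝓝 0) := by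
    have := (FloorSemiring.tendsto_pow_div_factorial_atTop (L * t)).const_mul (2 * M)
    simpa [mul_div_assoc] using this
  have hzero : ‖G (t, x) - F (t, x)‖ ≤ 0 :=
    ge_of_tendsto' hlim fun n => (hind n (t, x) ⟨ht, by simp⟩).1
  have := sub_eq_zero.1 (norm_le_zero_iff.1 hzero)
  simpa [hF, hG] using this

lemma IsSmoothWaveMapSolution.time_reversal {f : ℝ → EuclideanSpace ℝ (Fin m)}
    {φ : ℝ → ℝ → EuclideanSpace ℝ (Fin m)} (h : IsSmoothWaveMapSolution f φ) :
    IsSmoothWaveMapSolution f fun t x => φ (-t) x := by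
  refine ⟨?_, fun t x => ?_, fun x => ?_, fun x => ?_⟩
  · exact h.smooth.comp (f := fun p : ℝ × ℝ => (-p.1, p.2)) (by fun_prop)
  · have := h.equation (-t) x
    rw [iteratedDeriv_comp_neg 2 (fun s => φ s x), deriv_comp_neg (fun s => φ s x), norm_neg]
    simpa using this
  · simpa using h.initial_position x
  · rw [deriv_comp_neg (fun s => φ s x)]
    simpa using h.initial_velocity x

theorem IsSmoothWaveMapSolution.unique {f : ℝ → EuclideanSpace ℝ (Fin m)}
    {φ ψ : ℝ → ℝ → EuclideanSpace ℝ (Fin m)} (hφ : IsSmoothWaveMapSolution f φ)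
    (hψ : IsSmoothWaveMapSolution f ψ) : ψ = φ := by
  funext t x
  rcases le_total 0 t with ht | ht
  · exact hφ.eq_of_nonneg hψ ht x
  · simpa using hφ.time_reversal.eq_of_nonneg hψ.time_reversal (neg_nonneg.2 ht) x
end solution

/-! ### Fourier transforms of separating travelling profiles -/

lemma norm_fourier_le_integral_norm (f : ℝ → ℂ) (ξ : ℝ) : ‖𝓕 f ξ‖ ≤ ∫ x, ‖f x‖ :=
  VectorFourier.norm_fourierIntegral_le_integral_norm _ _ _ _ _

lemma continuous_fourier_of_integrable {f : ℝ → ℂ} (hf : Integrable f) : Continuous (𝓕 f) :=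
  VectorFourier.fourierIntegral_continuous Real.continuous_fourierChar
    (innerSL ℝ (E := ℝ)).continuous₂ hf

lemma norm_fourier_deriv {f : ℝ → ℂ} (hf : Integrable f) (hd : Differentiable ℝ f)
    (hf' : Integrable (deriv f)) (ξ : ℝ) :
    ‖𝓕 (deriv f) ξ‖ = 2 * Real.pi * (|ξ| * ‖𝓕 f ξ‖) := by
  rw [Real.fourier_deriv hf hd hf', norm_smul]
  simp [abs_of_pos Real.pi_pos]
  ring

lemma exists_fourier_decay {f : ℝ → ℂ} (hf : ContDiff ℝ 1 f) (hs : HasCompactSupport f) :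
    ∃ K, ∀ ξ, ‖𝓕 f ξ‖ ≤ K ∧ |ξ| * ‖𝓕 f ξ‖ ≤ K := by
  have hi : Integrable f := hf.continuous.integrable_of_hasCompactSupport hs
  have hi' : Integrable (deriv f) :=
    (hf.continuous_deriv le_rfl).integrable_of_hasCompactSupport hs.deriv
  refine ⟨(∫ x, ‖f x‖) + ∫ x, ‖deriv f x‖, fun ξ => ?_⟩
  have h0 : 0 ≤ ∫ x, ‖f x‖ := integral_nonneg fun _ => norm_nonneg _
  have h1 : 0 ≤ ∫ x, ‖deriv f x‖ := integral_nonneg fun _ => norm_nonneg _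
  have h2 := norm_fourier_le_integral_norm f ξ
  have h3 := norm_fourier_le_integral_norm (deriv f) ξ
  rw [norm_fourier_deriv hi (hf.differentiable (by norm_num)) hi'] at h3
  have h4 : 0 ≤ |ξ| * ‖𝓕 f ξ‖ := by positivity
  have := Real.pi_gt_three
  constructor <;> nlinarith

lemma fourier_comp_add_right (f : ℝ → ℂ) (T ξ : ℝ) :
    𝓕 (fun x => f (x + T)) ξ = Real.fourierChar (T * ξ) • 𝓕 f ξ := by
  rw [Real.fourier_real_eq, Real.fourier_real_eq]
  exact congrFun (Fourier.fourierIntegral_comp_add_right Real.fourierChar volume f T) ξ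

lemma exists_norm_fourier_sub_integral_le {f : ℝ → ℂ} (hf : Continuous f)
    (hs : HasCompactSupport f) : ∃ K, ∀ ξ, ‖𝓕 f ξ - ∫ x, f x‖ ≤ K * |ξ| := by
  have hi : Integrable f := hf.integrable_of_hasCompactSupport hs
  have hxf : Integrable fun x => x • f x :=
    (continuous_id.smul hf).integrable_of_hasCompactSupport hs.smul_left
  refine ⟨2 * Real.pi * ∫ x, ‖x • f x‖, fun ξ => ?_⟩
  have hint : Integrable fun x => Complex.exp (↑(-2 * Real.pi * x * ξ) * Complex.I) • f x := by
    have hc : Continuous fun x : ℝ =>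
        Complex.exp (↑(-2 * Real.pi * x * ξ) * Complex.I) • f x := by fun_prop
    exact hc.integrable_of_hasCompactSupport (hs.mono fun x hx => right_ne_zero_of_smul hx)
  rw [Real.fourier_real_eq_integral_exp_smul, ← integral_sub hint hi,
    show 2 * Real.pi * (∫ x, ‖x • f x‖) * |ξ| = ∫ x, 2 * Real.pi * |ξ| * ‖x • f x‖ by
      rw [integral_const_mul]; ring]
  refine norm_integral_le_of_norm_le (hxf.norm.const_mul _) (Eventually.of_forall fun x => ?_)
  rw [show ∀ z w : ℂ, z • w - w = (z - 1) • w by intro z w; simp; ring,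
    norm_smul, norm_smul, mul_comm _ Complex.I]
  refine (mul_le_mul_of_nonneg_right Real.norm_exp_I_mul_ofReal_sub_one_le
    (norm_nonneg _)).trans_eq ?_
  simp [abs_of_pos Real.pi_pos]
  ring

lemma integral_deriv_eq_sub_of_eventually_const {f : ℝ → ℂ} (hf : ContDiff ℝ 1 f)
    (hs : HasCompactSupport (deriv f)) {a b : ℂ} (ha : ∀ᶠ x in atBot, f x = a)
    (hb : ∀ᶠ x in atTop, f x = b) : ∫ x, deriv f x = b - a :=
  integral_of_hasDerivAt_of_tendsto
    (fun x => (hf.differentiable (by norm_num) x).hasDerivAt)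
    ((hf.continuous_deriv le_rfl).integrable_of_hasCompactSupport hs)
    (tendsto_const_nhds.congr' (ha.mono fun _ h => h.symm))
    (tendsto_const_nhds.congr' (hb.mono fun _ h => h.symm))


lemma exists_fourier_decay_two {f : ℝ → ℂ} (hf : ContDiff ℝ ∞ f) (hs : HasCompactSupport f) :
    ∃ K, ∀ ξ, ‖𝓕 f ξ‖ ≤ K ∧ |ξ| * ‖𝓕 f ξ‖ ≤ K ∧ |ξ| ^ 2 * ‖𝓕 f ξ‖ ≤ K := by
  have hf' : ContDiff ℝ ∞ (deriv f) := (contDiff_infty_iff_deriv.1 hf).2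
  obtain ⟨K₁, hK₁⟩ := exists_fourier_decay (contDiff_infty.1 hf 1) hs
  obtain ⟨K₂, hK₂⟩ := exists_fourier_decay (contDiff_infty.1 hf' 1) hs.deriv
  refine ⟨max K₁ K₂, fun ξ => ⟨(hK₁ ξ).1.trans (le_max_left _ _),
    (hK₁ ξ).2.trans (le_max_left _ _), le_trans ?_ (le_max_right _ _)⟩⟩
  have h := (hK₂ ξ).2
  rw [norm_fourier_deriv (hf.continuous.integrable_of_hasCompactSupport hs)
    (hf.differentiable (by simp)) (hf'.continuous.integrable_of_hasCompactSupport hs.deriv)] at h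
  have h4 : 0 ≤ |ξ| ^ 2 * ‖𝓕 f ξ‖ := by positivity
  nlinarith [Real.pi_gt_three]

/-- The superposition, up to the constant `c`, of the profile `l` moving left and of `r` moving
right, at time `T`. -/
def travellingPair (l r : ℝ → ℂ) (c : ℂ) (T x : ℝ) : ℂ := l (x + T) + r (x - T) - c

/-- The derivatives of the profiles have compact support, so the Fourier transform of the derivative
of the superposition is the sum of two modulated copies of fixed functions. -/
lemma fourier_travellingPair {l r : ℝ → ℂ} (hl : ContDiff ℝ ∞ l) (hr : ContDiff ℝ ∞ r)
    (hls : HasCompactSupport (deriv l)) (hrs : HasCompactSupport (deriv r)) {c : ℂ} {T : ℝ}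
    (hint : Integrable (travellingPair l r c T)) (ξ : ℝ) :
    2 * Real.pi * (|ξ| * ‖𝓕 (travellingPair l r c T) ξ‖) =
      ‖Real.fourierChar (T * ξ) • 𝓕 (deriv l) ξ +
        Real.fourierChar (-(T * ξ)) • 𝓕 (deriv r) ξ‖ := by
  have hd : ∀ {f : ℝ → ℂ}, ContDiff ℝ ∞ f → HasCompactSupport (deriv f) → Integrable (deriv f) :=
    fun hf hs => (contDiff_infty_iff_deriv.1 hf).2.continuous.integrable_of_hasCompactSupport hs
  have hder : ∀ x, HasDerivAt (travellingPair l r c T)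
      (deriv l (x + T) + deriv r (x - T)) x := fun x => by
    have h1 := ((hl.differentiable (by simp)) (x + T)).hasDerivAt.comp_add_const x T
    have h2 := ((hr.differentiable (by simp)) (x - T)).hasDerivAt.comp_sub_const x T
    exact (h1.add h2).sub_const c
  have hder' : deriv (travellingPair l r c T) = fun x => deriv l (x + T) + deriv r (x - T) :=
    funext fun x => (hder x).deriv
  have h1 := (hd hl hls).comp_add_right T
  have h2 := (hd hr hrs).comp_add_right (-T)
  simp only [← sub_eq_add_neg] at h2
  have h3 := fourier_comp_add_right (deriv r) (-T) ξ
  simp only [← sub_eq_add_neg, neg_mul] at h3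
  rw [← norm_fourier_deriv hint (fun x => (hder x).differentiableAt) (hder' ▸ h1.add h2), hder',
    ← fourier_comp_add_right (deriv l) T ξ, ← h3]
  exact congrArg norm (congrFun (VectorFourier.fourierIntegral_add Real.continuous_fourierChar
    (innerSL ℝ (E := ℝ)).continuous₂ h1 h2) ξ)

/-- Bounds for `|ξ| |ĝ|` and `|ξ|² |ĝ|` that are uniform in the time `T`. -/
lemma exists_fourier_decay_travellingPair {l r : ℝ → ℂ} (hl : ContDiff ℝ ∞ l)
    (hr : ContDiff ℝ ∞ r) (hls : HasCompactSupport (deriv l)) (hrs : HasCompactSupport (deriv r))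
    (c : ℂ) :
    ∃ K, ∀ T, Integrable (travellingPair l r c T) → ∀ ξ,
      |ξ| * ‖𝓕 (travellingPair l r c T) ξ‖ ≤ K ∧
      |ξ| ^ 2 * ‖𝓕 (travellingPair l r c T) ξ‖ ≤ K := by
  obtain ⟨K₁, hK₁⟩ := exists_fourier_decay
    (contDiff_infty.1 (contDiff_infty_iff_deriv.1 hl).2 1) hls
  obtain ⟨K₂, hK₂⟩ := exists_fourier_decay
    (contDiff_infty.1 (contDiff_infty_iff_deriv.1 hr).2 1) hrs
  refine ⟨K₁ + K₂, fun T hint ξ => ?_⟩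
  have h := fourier_travellingPair hl hr hls hrs hint ξ
  have htri := norm_add_le (Real.fourierChar (T * ξ) • 𝓕 (deriv l) ξ)
    (Real.fourierChar (-(T * ξ)) • 𝓕 (deriv r) ξ)
  rw [← h, Circle.norm_smul, Circle.norm_smul] at htri
  have hpos : 0 ≤ |ξ| * ‖𝓕 (travellingPair l r c T) ξ‖ := by positivity
  have hle : |ξ| * ‖𝓕 (travellingPair l r c T) ξ‖ ≤ ‖𝓕 (deriv l) ξ‖ + ‖𝓕 (deriv r) ξ‖ := by
    nlinarith [Real.pi_gt_three]
  obtain ⟨a1, a2⟩ := hK₁ ξ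
  obtain ⟨b1, b2⟩ := hK₂ ξ
  refine ⟨by linarith, ?_⟩
  calc |ξ| ^ 2 * ‖𝓕 (travellingPair l r c T) ξ‖
      = |ξ| * (|ξ| * ‖𝓕 (travellingPair l r c T) ξ‖) := by ring
    _ ≤ |ξ| * (‖𝓕 (deriv l) ξ‖ + ‖𝓕 (deriv r) ξ‖) := by gcongr
    _ ≤ K₁ + K₂ := by rw [mul_add]; linarith

/-- If the profiles are steps of heights `d` and `-d`, then at low frequencies the superposition
looks like `d` times the indicator function of `[-T, T]`, whose Fourier transform is
`sin (2πTξ) / (πξ)`. -/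
lemma exists_le_fourier_travellingPair {l r : ℝ → ℂ} (hl : ContDiff ℝ ∞ l)
    (hr : ContDiff ℝ ∞ r) (hls : HasCompactSupport (deriv l)) (hrs : HasCompactSupport (deriv r))
    {d : ℂ} (hld : ∫ x, deriv l x = d) (hrd : ∫ x, deriv r x = -d) (c : ℂ) :
    ∃ K, 0 ≤ K ∧ ∀ T, Integrable (travellingPair l r c T) → ∀ ξ,
      2 * ‖d‖ * |Real.sin (2 * Real.pi * T * ξ)| - K * |ξ| ≤
        2 * Real.pi * (|ξ| * ‖𝓕 (travellingPair l r c T) ξ‖) := by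
  obtain ⟨K₁, hK₁⟩ := exists_norm_fourier_sub_integral_le
    (contDiff_infty_iff_deriv.1 hl).2.continuous hls
  obtain ⟨K₂, hK₂⟩ := exists_norm_fourier_sub_integral_le
    (contDiff_infty_iff_deriv.1 hr).2.continuous hrs
  have hK₁0 := (norm_nonneg _).trans (hK₁ 1)
  have hK₂0 := (norm_nonneg _).trans (hK₂ 1)
  simp only [abs_one, mul_one] at hK₁0 hK₂0
  refine ⟨K₁ + K₂, by positivity, fun T hint ξ => ?_⟩
  rw [fourier_travellingPair hl hr hls hrs hint ξ]
  have h1 := hK₁ ξ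
  have h2 := hK₂ ξ
  rw [hld] at h1
  rw [hrd] at h2
  have e : Real.fourierChar (T * ξ) • d + Real.fourierChar (-(T * ξ)) • (-d) =
      (2 * Complex.I * (Real.sin (2 * Real.pi * T * ξ) : ℝ)) * d := by
    rw [Circle.smul_def, Circle.smul_def, Real.fourierChar_apply, Real.fourierChar_apply,
      Complex.exp_mul_I, Complex.exp_mul_I]
    push_cast
    rw [show (2 * (Real.pi : ℂ) * -(T * ξ)) = -(2 * Real.pi * T * ξ) by ring,
      show (2 * (Real.pi : ℂ) * (T * ξ)) = 2 * Real.pi * T * ξ by ring,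
      Complex.cos_neg, Complex.sin_neg, smul_eq_mul, smul_eq_mul]
    ring
  have hn : ‖(2 * Complex.I * (Real.sin (2 * Real.pi * T * ξ) : ℝ)) * d‖ =
      2 * ‖d‖ * |Real.sin (2 * Real.pi * T * ξ)| := by
    rw [norm_mul, norm_mul, Complex.norm_real]
    simp
    ring
  rw [← hn, ← e]
  have h3 := norm_sub_norm_le (Real.fourierChar (T * ξ) • d + Real.fourierChar (-(T * ξ)) • (-d))
    (Real.fourierChar (T * ξ) • 𝓕 (deriv l) ξ + Real.fourierChar (-(T * ξ)) • 𝓕 (deriv r) ξ)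
  have h4 : ‖(Real.fourierChar (T * ξ) • d + Real.fourierChar (-(T * ξ)) • (-d)) -
      (Real.fourierChar (T * ξ) • 𝓕 (deriv l) ξ +
        Real.fourierChar (-(T * ξ)) • 𝓕 (deriv r) ξ)‖ ≤ K₁ * |ξ| + K₂ * |ξ| := by
    rw [add_sub_add_comm, ← smul_sub, ← smul_sub]
    refine (norm_add_le _ _).trans ?_
    rw [Circle.norm_smul, Circle.norm_smul, norm_sub_rev, norm_sub_rev (-d)]
    exact add_le_add h1 h2
  linarith

/-! ### Dyadic sums -/

/-- The dyadic frequency shell `2^j ≤ |ξ| < 2^(j+1)`. -/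
def dyadicShell (j : ℤ) : Set ℝ := {ξ : ℝ | (2 : ℝ) ^ j ≤ |ξ| ∧ |ξ| < (2 : ℝ) ^ (j + 1)}

lemma measurableSet_dyadicShell (j : ℤ) : MeasurableSet (dyadicShell j) :=
  (measurableSet_le measurable_const continuous_abs.measurable).inter
    (measurableSet_lt continuous_abs.measurable measurable_const)

lemma pairwise_disjoint_dyadicShell : Pairwise (Function.onFun Disjoint dyadicShell) := by
  have key : ∀ i j : ℤ, i < j → Disjoint (dyadicShell i) (dyadicShell j) := by
    intro i j hij
    rw [Set.disjoint_left]
    rintro ξ ⟨_, h1⟩ ⟨h2, _⟩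
    exact absurd (h1.trans_le ((zpow_le_zpow_right₀ one_le_two (by omega)).trans h2)) (lt_irrefl _)
  intro i j hij
  rcases lt_or_gt_of_ne hij with h | h
  exacts [key i j h, (key j i h).symm]

lemma iUnion_dyadicShell : ⋃ j, dyadicShell j = {(0 : ℝ)}ᶜ := by
  ext ξ
  simp only [Set.mem_iUnion, Set.mem_compl_iff, Set.mem_singleton_iff]
  constructor
  · rintro ⟨j, hj, _⟩ rfl
    have : (0 : ℝ) < 2 ^ j := by positivity
    rw [abs_zero] at hj
    linarith
  · intro h
    obtain ⟨j, hj⟩ := exists_mem_Ico_zpow (abs_pos.2 h) one_lt_two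
    exact ⟨j, hj⟩

lemma lintegral_eq_tsum_dyadicShell (f : ℝ → ℝ≥0∞) :
    ∫⁻ ξ, f ξ = ∑' j, ∫⁻ ξ in dyadicShell j, f ξ := by
  rw [← lintegral_iUnion measurableSet_dyadicShell pairwise_disjoint_dyadicShell,
    iUnion_dyadicShell, restrict_compl_singleton]

lemma volume_dyadicShell_le (j : ℤ) : volume (dyadicShell j) ≤ ENNReal.ofReal (2 * 2 ^ j) := by
  have hsub : dyadicShell j ⊆
      Set.Ico (2 ^ j : ℝ) (2 ^ (j + 1)) ∪ Set.Ioc (-2 ^ (j + 1) : ℝ) (-2 ^ j) := by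
    rintro ξ ⟨h1, h2⟩
    rcases abs_cases ξ with ⟨h, _⟩ | ⟨h, _⟩
    · exact Or.inl ⟨by linarith, by linarith⟩
    · exact Or.inr ⟨by linarith, by linarith⟩
  refine (measure_mono hsub).trans ((measure_union_le _ _).trans ?_)
  have hp : (0 : ℝ) < 2 ^ j := by positivity
  rw [Real.volume_Ico, Real.volume_Ioc, zpow_add_one₀ two_ne_zero,
    ← ENNReal.ofReal_add (by linarith) (by linarith)]
  exact ENNReal.ofReal_le_ofReal (by linarith)

/-- The energy `2^j ∫_{2^j ≤ |ξ| < 2^(j+1)} N` of a shell, for `N = |ĝ|²`. Its square roots sum to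
the `Ḃ^{1/2,1}_2` norm of `g`, and the energies themselves to its squared `Ḣ^{1/2}` norm, up to a
factor between `1` and `2`. -/
def dyadicEnergy (N : ℝ → ℝ) (j : ℤ) : ℝ≥0∞ :=
  ENNReal.ofReal (2 ^ j) * ∫⁻ ξ in dyadicShell j, ENNReal.ofReal (N ξ)

lemma homBesovNorm_half {m : ℕ} (g : ℝ → EuclideanSpace ℝ (Fin m)) :
    homBesovNorm (1 / 2) g = ∑' j, dyadicEnergy (fourierNormSq g) j ^ (1 / 2 : ℝ) := by
  unfold homBesovNorm dyadicEnergy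
  congr 1
  funext j
  rw [ENNReal.mul_rpow_of_nonneg _ _ (by norm_num : (0 : ℝ) ≤ 1 / 2),
    ENNReal.ofReal_rpow_of_pos (by positivity), Real.rpow_mul two_pos.le, Real.rpow_intCast]
  rfl

/-- The square of the `Ḣ^{1/2}` norm. -/
def homSobolevEnergy {m : ℕ} (g : ℝ → EuclideanSpace ℝ (Fin m)) : ℝ≥0∞ :=
  ∫⁻ ξ : ℝ, ENNReal.ofReal (|ξ| * fourierNormSq g ξ)

lemma homSobolevNorm_half {m : ℕ} (g : ℝ → EuclideanSpace ℝ (Fin m)) :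
    homSobolevNorm (1 / 2) g = homSobolevEnergy g ^ (1 / 2 : ℝ) := by
  simp [homSobolevNorm, homSobolevEnergy]

lemma tsum_dyadicEnergy_le_homSobolevEnergy {m : ℕ} (g : ℝ → EuclideanSpace ℝ (Fin m)) :
    ∑' j, dyadicEnergy (fourierNormSq g) j ≤ homSobolevEnergy g := by
  rw [homSobolevEnergy, lintegral_eq_tsum_dyadicShell]
  refine ENNReal.tsum_le_tsum fun j => ?_
  rw [dyadicEnergy, ← lintegral_const_mul' _ _ ENNReal.ofReal_ne_top]
  refine setLIntegral_mono' (measurableSet_dyadicShell j) fun ξ hξ => ?_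
  rw [← ENNReal.ofReal_mul (by positivity)]
  have : 0 ≤ fourierNormSq g ξ := Finset.sum_nonneg fun i _ => by positivity
  exact ENNReal.ofReal_le_ofReal (by gcongr; exact hξ.1)

lemma homSobolevEnergy_le_tsum_dyadicEnergy {m : ℕ} (g : ℝ → EuclideanSpace ℝ (Fin m)) :
    homSobolevEnergy g ≤ 2 * ∑' j, dyadicEnergy (fourierNormSq g) j := by
  rw [homSobolevEnergy, lintegral_eq_tsum_dyadicShell, ← ENNReal.tsum_mul_left]
  refine ENNReal.tsum_le_tsum fun j => ?_
  rw [dyadicEnergy, ← lintegral_const_mul' _ _ ENNReal.ofReal_ne_top,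
    ← lintegral_const_mul' _ _ ENNReal.ofNat_ne_top]
  refine setLIntegral_mono' (measurableSet_dyadicShell j) fun ξ hξ => ?_
  have : 0 ≤ fourierNormSq g ξ := Finset.sum_nonneg fun i _ => by positivity
  rw [← ENNReal.ofReal_mul (by positivity), ← ENNReal.ofReal_ofNat 2,
    ← ENNReal.ofReal_mul (by positivity), ← mul_assoc]
  refine ENNReal.ofReal_le_ofReal ?_
  gcongr
  have h2 := hξ.2
  rw [zpow_add_one₀ two_ne_zero] at h2
  linarith

/-- Decay of `N = |ĝ|²` for `g` of the shape of a mollified indicator function of an interval of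
length `T`: `N` is at most `K` times the minimum of `T²`, `|ξ|⁻²` and `|ξ|⁻⁴`. -/
structure FourierDecay (N : ℝ → ℝ) (K T : ℝ) : Prop where
  low : ∀ ξ, N ξ ≤ K * T ^ 2
  mid : ∀ ξ, |ξ| ^ 2 * N ξ ≤ K
  high : ∀ ξ, |ξ| ^ 4 * N ξ ≤ K

/-- A summable majorant of `min (2^(n+j)) 1 (2^(-j))`: one on the `n` shells between the frequencies
`2^(-n)` and `1`, with geometric tails on both sides. -/
def dyadicWeight (n : ℕ) (j : ℤ) : ℝ :=
  (1 / 2) ^ j.natAbs + (if j ∈ Finset.Ico (-(n : ℤ)) 0 then 1 else 0) +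
    (1 / 2) ^ (j + n).natAbs

lemma dyadicWeight_nonneg (n : ℕ) (j : ℤ) : 0 ≤ dyadicWeight n j := by
  unfold dyadicWeight
  positivity

lemma summable_half_pow_natAbs : Summable fun j : ℤ => (1 / 2 : ℝ) ^ j.natAbs :=
  Summable.of_nat_of_neg (by simpa using summable_geometric_two) (by
    simpa using summable_geometric_two)

lemma exists_hasSum_dyadicWeight : ∃ W : ℝ, 0 ≤ W ∧
    ∀ n : ℕ, HasSum (dyadicWeight n) (2 * W + n) := by
  refine ⟨∑' j : ℤ, (1 / 2 : ℝ) ^ j.natAbs, tsum_nonneg fun j => by positivity, fun n => ?_⟩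
  have h := summable_half_pow_natAbs.hasSum
  have h2 : HasSum (fun j : ℤ => (1 / 2 : ℝ) ^ (j + n).natAbs)
      (∑' j : ℤ, (1 / 2 : ℝ) ^ j.natAbs) :=
    (Equiv.addRight (n : ℤ)).hasSum_iff (f := fun j : ℤ => (1 / 2 : ℝ) ^ j.natAbs) |>.2 h
  have h3 : HasSum (fun j : ℤ => if j ∈ Finset.Ico (-(n : ℤ)) 0 then (1 : ℝ) else 0) n := by
    have hcard : ∑ j ∈ Finset.Ico (-(n : ℤ)) 0,
        (if j ∈ Finset.Ico (-(n : ℤ)) 0 then (1 : ℝ) else 0) = n := by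
      rw [Finset.sum_congr rfl fun j hj => if_pos hj, Finset.sum_const, Int.card_Ico]
      simp
    have := hasSum_sum_of_ne_finset_zero (L := SummationFilter.unconditional ℤ)
      (s := Finset.Ico (-(n : ℤ)) 0)
      (f := fun j : ℤ => if j ∈ Finset.Ico (-(n : ℤ)) 0 then (1 : ℝ) else 0)
      (fun j hj => if_neg hj)
    rwa [hcard] at this
  have hadd := (h.add h3).add h2
  rw [show ∀ a b : ℝ, a + b + a = 2 * a + b by intro a b; ring] at hadd
  exact hadd

lemma min_le_dyadicWeight (n : ℕ) {j : ℤ} :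
    min (2 ^ (n + j)) (min 1 (2 ^ (-j))) ≤ dyadicWeight n j := by
  have half : ∀ i : ℤ, i ≤ 0 → (2 : ℝ) ^ i = (1 / 2) ^ i.natAbs := by
    intro i hi
    obtain ⟨k, rfl⟩ : ∃ k : ℕ, i = -k := ⟨i.natAbs, by omega⟩
    simp
  have p1 : (0 : ℝ) ≤ (1 / 2) ^ j.natAbs := by positivity
  have p2 : (0 : ℝ) ≤ (1 / 2) ^ (j + n).natAbs := by positivity
  unfold dyadicWeight
  rcases le_or_gt 0 j with h | h
  · rw [if_neg (by simp; omega)]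
    refine ((min_le_right _ _).trans (min_le_right _ _)).trans ?_
    rw [half _ (by omega), Int.natAbs_neg]
    linarith
  · rcases le_or_gt (-(n : ℤ)) j with h' | h'
    · rw [if_pos (by simp; omega)]
      refine ((min_le_right _ _).trans (min_le_left _ _)).trans ?_
      linarith
    · rw [if_neg (by simp; omega)]
      refine (min_le_left _ _).trans ?_
      rw [half _ (by omega), add_comm]
      linarith

lemma dyadicEnergy_le {N : ℝ → ℝ} {K T : ℝ} (hK : 0 ≤ K) (hT : 0 ≤ T) (hN : FourierDecay N K T)
    {n : ℕ} (hn : T ≤ 2 ^ n) (j : ℤ) :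
    dyadicEnergy N j ≤
      ENNReal.ofReal (2 * K * (min (2 ^ (n + j)) (min 1 (2 ^ (-j)))) ^ 2) := by
  have hj : (0 : ℝ) < 2 ^ j := by positivity
  set μ : ℝ := min (2 ^ (n + j)) (min 1 (2 ^ (-j))) with hμ
  have hpt : ∀ ξ ∈ dyadicShell j, N ξ ≤ K * μ ^ 2 / (2 ^ j) ^ 2 := by
    rintro ξ ⟨h1, -⟩
    rw [le_div_iff₀ (by positivity)]
    rcases le_or_gt (N ξ) 0 with hneg | hpos
    · have : 0 ≤ K * μ ^ 2 := by positivity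
      nlinarith [sq_nonneg ((2 : ℝ) ^ j)]
    have hx : (2 ^ j : ℝ) ^ 2 ≤ |ξ| ^ 2 := by gcongr
    have hx4 : (2 ^ j : ℝ) ^ 4 ≤ |ξ| ^ 4 := by gcongr
    have b1 : N ξ * (2 ^ j) ^ 2 ≤ K * (2 ^ (n + j)) ^ 2 := by
      rw [zpow_add₀ two_ne_zero, zpow_natCast, mul_pow, ← mul_assoc]
      gcongr
      exact (hN.low ξ).trans (by gcongr)
    have b2 : N ξ * (2 ^ j) ^ 2 ≤ K * 1 ^ 2 := by
      nlinarith [hN.mid ξ]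
    have b3 : N ξ * (2 ^ j) ^ 2 ≤ K * (2 ^ (-j)) ^ 2 := by
      have : N ξ * (2 ^ j) ^ 4 ≤ K := by nlinarith [hN.high ξ]
      rw [zpow_neg, inv_pow, ← div_eq_mul_inv, le_div_iff₀ (by positivity)]
      calc _ = N ξ * (2 ^ j) ^ 4 := by ring
        _ ≤ K := this
    rcases min_choice ((2 : ℝ) ^ (n + j)) (min 1 (2 ^ (-j))) with h | h
    · rw [hμ, h]; exact b1
    · rcases min_choice (1 : ℝ) (2 ^ (-j)) with h' | h'
      · rw [hμ, h, h']; exact b2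
      · rw [hμ, h, h']; exact b3
  have hc : 0 ≤ K * μ ^ 2 / (2 ^ j) ^ 2 := by positivity
  calc dyadicEnergy N j
      ≤ ENNReal.ofReal (2 ^ j) *
          ∫⁻ _ in dyadicShell j, ENNReal.ofReal (K * μ ^ 2 / (2 ^ j) ^ 2) := by
        refine mul_le_mul_right (setLIntegral_mono' (measurableSet_dyadicShell j)
          fun ξ hξ => ENNReal.ofReal_le_ofReal (hpt ξ hξ)) _
    _ ≤ ENNReal.ofReal (2 ^ j) * (ENNReal.ofReal (K * μ ^ 2 / (2 ^ j) ^ 2) *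
          ENNReal.ofReal (2 * 2 ^ j)) := by
        rw [setLIntegral_const]
        gcongr
        exact volume_dyadicShell_le j
    _ = ENNReal.ofReal (2 * K * μ ^ 2) := by
        rw [← ENNReal.ofReal_mul hc, ← ENNReal.ofReal_mul hj.le]
        congr 1
        field_simp

/-- Upper bounds linear in `n ≈ log₂ T`: each of the `n` shells between `2^(-n)` and `1` contributes
`O(1)`, and all the others together contribute `O(1)`. -/
lemma exists_norm_le_of_fourierDecay : ∃ W : ℝ, 0 ≤ W ∧ ∀ {m : ℕ}
    {g : ℝ → EuclideanSpace ℝ (Fin m)} {K T : ℝ} {n : ℕ}, 0 ≤ K → 0 ≤ T → T ≤ 2 ^ n →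
      FourierDecay (fourierNormSq g) K T →
      homBesovNorm (1 / 2) g ≤ ENNReal.ofReal (√(2 * K) * (W + n)) ∧
      homSobolevEnergy g ≤ ENNReal.ofReal (4 * K * (W + n)) := by
  obtain ⟨W, hW, hsum⟩ := exists_hasSum_dyadicWeight
  refine ⟨2 * W, by positivity, fun {m g K T n} hK hT hn hg => ?_⟩
  have hmin : ∀ j : ℤ, 0 ≤ min ((2 : ℝ) ^ (n + j)) (min 1 (2 ^ (-j))) := fun j => by positivity
  have hmin1 : ∀ j : ℤ, min ((2 : ℝ) ^ (n + j)) (min 1 (2 ^ (-j))) ≤ 1 := fun j =>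
    (min_le_right _ _).trans (min_le_left _ _)
  have hS : ∀ c : ℝ, 0 ≤ c →
      ∑' j, ENNReal.ofReal (c * dyadicWeight n j) = ENNReal.ofReal (c * (2 * W + n)) := by
    intro c hc
    rw [← ENNReal.ofReal_tsum_of_nonneg (fun j => mul_nonneg hc (dyadicWeight_nonneg n j))
      ((hsum n).summable.mul_left c), ((hsum n).mul_left c).tsum_eq]
  constructor
  · rw [homBesovNorm_half, ← hS _ (Real.sqrt_nonneg _)]
    refine ENNReal.tsum_le_tsum fun j => ?_
    refine (ENNReal.rpow_le_rpow (dyadicEnergy_le hK hT hg hn j) (by norm_num)).trans ?_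
    rw [ENNReal.ofReal_rpow_of_nonneg (by positivity) (by norm_num), ← Real.sqrt_eq_rpow,
      Real.sqrt_mul (by positivity), Real.sqrt_sq (hmin j)]
    exact ENNReal.ofReal_le_ofReal (by gcongr; exact min_le_dyadicWeight n)
  · refine (homSobolevEnergy_le_tsum_dyadicEnergy g).trans ?_
    have : ∑' j, dyadicEnergy (fourierNormSq g) j ≤ ENNReal.ofReal (2 * K * (2 * W + n)) := by
      rw [← hS _ (by positivity)]
      refine ENNReal.tsum_le_tsum fun j => (dyadicEnergy_le hK hT hg hn j).trans ?_
      refine ENNReal.ofReal_le_ofReal ?_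
      gcongr
      refine le_trans ?_ (min_le_dyadicWeight n)
      exact pow_le_of_le_one (hmin j) (hmin1 j) two_ne_zero
    calc _ ≤ 2 * ENNReal.ofReal (2 * K * (2 * W + n)) := by gcongr
      _ = _ := by
        rw [← ENNReal.ofReal_ofNat 2, ← ENNReal.ofReal_mul (by norm_num)]
        congr 1
        ring

lemma le_integral_sin_sq {A T : ℝ} (hT : 0 < T) (hAT : 1 ≤ T * A) :
    A / 4 ≤ ∫ ξ in A..(2 * A), Real.sin (2 * Real.pi * T * ξ) ^ 2 := by
  have hpi := Real.pi_gt_three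
  have hc : 0 < 2 * Real.pi * T := by positivity
  rw [intervalIntegral.integral_comp_mul_left (fun x => Real.sin x ^ 2) hc.ne', integral_sin_sq,
    smul_eq_mul, ← div_eq_inv_mul, le_div_iff₀ hc]
  have h : ∀ x : ℝ, |Real.sin x * Real.cos x| ≤ 1 / 2 := fun x => by
    rw [abs_le]
    constructor <;> nlinarith [sq_nonneg (Real.sin x + Real.cos x),
      sq_nonneg (Real.sin x - Real.cos x), Real.sin_sq_add_cos_sq x]
  have h1 := abs_le.1 (h (2 * Real.pi * T * A))
  have h2 := abs_le.1 (h (2 * Real.pi * T * (2 * A)))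
  nlinarith

/-- A shell at frequency between `1 / T` and a constant carries an energy bounded below: it is wide
enough for `sin²` to have average about `1/2` on it. -/
lemma le_dyadicEnergy {N : ℝ → ℝ} (hNc : Continuous N) (hN0 : ∀ ξ, 0 ≤ N ξ) {a b T : ℝ}
    (ha : 0 ≤ a) (hT : 0 < T)
    (hN : ∀ ξ, a * Real.sin (2 * Real.pi * T * ξ) ^ 2 - b * ξ ^ 2 ≤ ξ ^ 2 * N ξ) {j : ℤ}
    (hj : 1 ≤ T * 2 ^ j) (hjb : b * (2 ^ j) ^ 2 ≤ a / 32) :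
    ENNReal.ofReal (a / 32) ≤ dyadicEnergy N j := by
  have hA : (0 : ℝ) < 2 ^ j := by positivity
  set A : ℝ := 2 ^ j with hAdef
  have hsub : Set.Ioo A (2 * A) ⊆ dyadicShell j := fun ξ hξ => by
    have : 0 < ξ := hA.trans hξ.1
    refine ⟨by rw [abs_of_pos this]; exact hξ.1.le, ?_⟩
    rw [abs_of_pos this, zpow_add_one₀ two_ne_zero]
    linarith [hξ.2]
  have hint : A * (a / (4 * A ^ 2) * (A / 4) - b * A) ≤ A * ∫ ξ in A..(2 * A), N ξ := by
    refine mul_le_mul_of_nonneg_left ?_ hA.le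
    have h1 := le_integral_sin_sq hT hj
    have hmono : ∫ ξ in A..(2 * A), (a / (4 * A ^ 2) * Real.sin (2 * Real.pi * T * ξ) ^ 2 - b) ≤
        ∫ ξ in A..(2 * A), N ξ := by
      refine intervalIntegral.integral_mono_on (by linarith)
        (Continuous.intervalIntegrable (by fun_prop) _ _) (hNc.intervalIntegrable _ _)
        fun ξ hξ => ?_
      have hξ0 : 0 < ξ := hA.trans_le hξ.1
      have hξ2 : ξ ^ 2 ≤ 4 * A ^ 2 := by nlinarith [hξ.2]
      have hs : a * Real.sin (2 * Real.pi * T * ξ) ^ 2 ≤ (N ξ + b) * ξ ^ 2 := by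
        linarith [hN ξ]
      have hs' : a * Real.sin (2 * Real.pi * T * ξ) ^ 2 / (4 * A ^ 2) ≤
          a * Real.sin (2 * Real.pi * T * ξ) ^ 2 / ξ ^ 2 := by gcongr
      rw [← div_le_iff₀ (by positivity)] at hs
      rw [div_mul_eq_mul_div]
      linarith
    rw [intervalIntegral.integral_sub (Continuous.intervalIntegrable (by fun_prop) _ _)
      (by simp), intervalIntegral.integral_const_mul, intervalIntegral.integral_const,
      smul_eq_mul] at hmono
    have h2 : a / (4 * A ^ 2) * (A / 4) ≤ a / (4 * A ^ 2) *
      ∫ ξ in A..(2 * A), Real.sin (2 * Real.pi * T * ξ) ^ 2 := by gcongr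
    linarith
  have hlow : a / 32 ≤ A * ∫ ξ in A..(2 * A), N ξ := by
    have : A * (a / (4 * A ^ 2) * (A / 4) - b * A) = a / 16 - b * A ^ 2 := by
      field_simp
      ring
    linarith
  calc ENNReal.ofReal (a / 32) ≤ ENNReal.ofReal (A * ∫ ξ in A..(2 * A), N ξ) :=
        ENNReal.ofReal_le_ofReal hlow
    _ = ENNReal.ofReal A * ∫⁻ ξ in Set.Ioo A (2 * A), ENNReal.ofReal (N ξ) := by
        rw [ENNReal.ofReal_mul hA.le, intervalIntegral.integral_of_le (by linarith),
          integral_Ioc_eq_integral_Ioo, ofReal_integral_eq_lintegral_ofReal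
            ((hNc.integrableOn_Icc).mono_set Set.Ioo_subset_Icc_self)
            (Eventually.of_forall hN0)]
    _ ≤ dyadicEnergy N j := by
        unfold dyadicEnergy
        gcongr

/-- Lower bounds linear in `n ≈ log₂ T`: the `n - j₀` shells between `2^(-n)` and `2^(-j₀)`
contribute at least a constant each. -/
lemma exists_le_norm_of_fourier_lower {a b : ℝ} (ha : 0 < a) : ∃ j₀ : ℕ, ∀ {m : ℕ}
    {g : ℝ → EuclideanSpace ℝ (Fin m)} {T : ℝ} {n : ℕ}, Continuous (fourierNormSq g) → 
      2 ^ n ≤ T →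
      (∀ ξ, a * Real.sin (2 * Real.pi * T * ξ) ^ 2 - b * ξ ^ 2 ≤ ξ ^ 2 * fourierNormSq g ξ) →
      ENNReal.ofReal (√(a / 32) * (n - j₀)) ≤ homBesovNorm (1 / 2) g ∧
      ENNReal.ofReal (a / 32 * (n - j₀)) ≤ homSobolevEnergy g := by
  obtain ⟨j₀, hj₀⟩ : ∃ j₀ : ℕ, b * (1 / 2) ^ j₀ ≤ a / 32 := by
    have h : Tendsto (fun j : ℕ => b * (1 / 2 : ℝ) ^ j) atTop (𝓝 (b * 0)) :=
      (tendsto_pow_atTop_nhds_zero_of_lt_one (by norm_num) (by norm_num)).const_mul b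
    rw [mul_zero] at h
    exact (h.eventually (ge_mem_nhds (by positivity))).exists
  refine ⟨j₀, fun {m g T n} hc hT hg => ?_⟩
  have hT0 : 0 < T := lt_of_lt_of_le (by positivity) hT
  have hpt : ∀ j ∈ Finset.Ico (-(n : ℤ)) (-j₀),
      ENNReal.ofReal (a / 32) ≤ dyadicEnergy (fourierNormSq g) j := by
    intro j hj
    rw [Finset.mem_Ico] at hj
    have hjp : (0 : ℝ) < 2 ^ j := by positivity
    refine le_dyadicEnergy hc (fun ξ => Finset.sum_nonneg fun i _ => by positivity) ha.le hT0 hg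
      ?_ ?_
    · calc (1 : ℝ) ≤ 2 ^ (n + j) := one_le_zpow₀ one_le_two (by omega)
        _ = 2 ^ n * 2 ^ j := by rw [zpow_add₀ two_ne_zero, zpow_natCast]
        _ ≤ T * 2 ^ j := by gcongr
    · have h1 : (2 : ℝ) ^ j ≤ (1 / 2) ^ j₀ := by
        rw [one_div, inv_pow, ← zpow_natCast, ← zpow_neg]
        exact zpow_le_zpow_right₀ one_le_two (by omega)
      have h2 : ((2 : ℝ) ^ j) ^ 2 ≤ (1 / 2) ^ j₀ := by
        refine le_trans ?_ h1
        refine pow_le_of_le_one hjp.le (h1.trans ?_) two_ne_zero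
        exact pow_le_one₀ (by norm_num) (by norm_num)
      rcases le_or_gt b 0 with hb | hb
      · have : 0 ≤ ((2 : ℝ) ^ j) ^ 2 := by positivity
        nlinarith
      · exact (mul_le_mul_of_nonneg_left h2 hb.le).trans hj₀
  have hcount : ∀ (f : ℤ → ℝ≥0∞) (c : ℝ), 0 ≤ c →
      (∀ j ∈ Finset.Ico (-(n : ℤ)) (-j₀), ENNReal.ofReal c ≤ f j) →
      ENNReal.ofReal (c * (n - j₀)) ≤ ∑' j, f j := by
    intro f c hc hf
    refine le_trans ?_ (ENNReal.sum_le_tsum (Finset.Ico (-(n : ℤ)) (-j₀)))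
    refine le_trans ?_ (Finset.card_nsmul_le_sum _ _ _ hf)
    rw [Int.card_Ico, nsmul_eq_mul, ← ENNReal.ofReal_natCast, ← ENNReal.ofReal_mul (by positivity),
      mul_comm]
    refine ENNReal.ofReal_le_ofReal (mul_le_mul_of_nonneg_right ?_ hc)
    have := Int.self_le_toNat (-(j₀ : ℤ) - -n)
    have h' : ((-(j₀ : ℤ) - -n : ℤ) : ℝ) ≤ ((-(j₀ : ℤ) - -n).toNat : ℝ) := by exact_mod_cast this
    push_cast at h'
    linarith
  constructor
  · rw [homBesovNorm_half]
    refine hcount _ _ (Real.sqrt_nonneg _) fun j hj => ?_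
    rw [Real.sqrt_eq_rpow, ← ENNReal.ofReal_rpow_of_nonneg (by positivity) (by norm_num)]
    exact ENNReal.rpow_le_rpow (hpt j hj) (by norm_num)
  · exact (hcount _ _ (by positivity) hpt).trans (tsum_dyadicEnergy_le_homSobolevEnergy g)

/-- Bounds linear in `n` for `2^n ≤ T ≤ 2^(n+1)` say that a quantity is comparable with `log T`. -/
lemma isTheta_log_of_dyadic_bounds {X : ℝ → ℝ≥0∞} {c K T₀ : ℝ} {W j₀ : ℝ} (hc : 0 < c)
    (h : ∀ (n : ℕ) (T : ℝ), T₀ ≤ T → 2 ^ n ≤ T → T ≤ 2 ^ (n + 1) →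
      ENNReal.ofReal (c * (n - j₀)) ≤ X T ∧ X T ≤ ENNReal.ofReal (K * (W + n))) :
    (fun T => (X T).toReal) =Θ[atTop] Real.log := by
  have hlog2 : 0 < Real.log 2 := Real.log_pos one_lt_two
  have hev : ∀ᶠ T : ℝ in atTop, T₀ ≤ T ∧ 1 ≤ T ∧ 1 ≤ Real.log T ∧
      2 * Real.log 2 * (1 + j₀) ≤ Real.log T :=
    (eventually_ge_atTop T₀).and ((eventually_ge_atTop 1).and
      ((Real.tendsto_log_atTop.eventually_ge_atTop 1).and
        (Real.tendsto_log_atTop.eventually_ge_atTop _)))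
  have hn : ∀ {T : ℝ}, 1 ≤ T → ∃ n : ℕ, 2 ^ n ≤ T ∧ T ≤ 2 ^ (n + 1) ∧
      n * Real.log 2 ≤ Real.log T ∧ Real.log T ≤ (n + 1) * Real.log 2 := by
    intro T hT
    obtain ⟨n, h1, h2⟩ := exists_nat_pow_near hT one_lt_two
    refine ⟨n, h1, h2.le, ?_, ?_⟩
    · rw [← Real.log_pow]
      exact Real.log_le_log (by positivity) h1
    · have := Real.log_le_log (by positivity) h2.le
      rw [Real.log_pow] at this
      exact_mod_cast this
  constructor
  · refine Asymptotics.IsBigO.of_bound (|K| * (|W| + 1 / Real.log 2)) ?_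
    filter_upwards [hev] with T ⟨hT₀, hT1, hlog, hlog'⟩
    obtain ⟨n, h1, h2, h3, h4⟩ := hn hT1
    have hX := ENNReal.toReal_mono ENNReal.ofReal_ne_top (h n T hT₀ h1 h2).2
    rw [Real.norm_of_nonneg ENNReal.toReal_nonneg, Real.norm_of_nonneg (by linarith)]
    refine hX.trans ?_
    rw [ENNReal.toReal_ofReal']
    refine max_le ?_ (by positivity)
    have h5 : (n : ℝ) ≤ 1 / Real.log 2 * Real.log T := by
      rw [one_div, ← div_eq_inv_mul, le_div_iff₀ hlog2]
      exact h3
    have h6 : W ≤ |W| * Real.log T := by nlinarith [le_abs_self W, abs_nonneg W]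
    calc K * (W + n) ≤ |K| * |W + n| := by rw [← abs_mul]; exact le_abs_self _
      _ ≤ |K| * (|W| + n) := by
        gcongr
        refine (abs_add_le _ _).trans_eq ?_
        rw [abs_of_nonneg (Nat.cast_nonneg (α := ℝ) n)]
      _ ≤ |K| * (|W| * Real.log T + 1 / Real.log 2 * Real.log T) := by
        gcongr
        nlinarith [abs_nonneg W]
      _ = _ := by ring
  · refine Asymptotics.IsBigO.of_bound (2 * Real.log 2 / c) ?_
    filter_upwards [hev] with T ⟨hT₀, hT1, hlog, hlog'⟩
    obtain ⟨n, h1, h2, h3, h4⟩ := hn hT1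
    obtain ⟨hl, hu⟩ := h n T hT₀ h1 h2
    have hX := ENNReal.toReal_mono (hu.trans_lt ENNReal.ofReal_lt_top).ne hl
    rw [Real.norm_of_nonneg ENNReal.toReal_nonneg, Real.norm_of_nonneg (by linarith)]
    rw [ENNReal.toReal_ofReal'] at hX
    have hX' := (le_max_left _ _).trans hX
    have h5 : Real.log T ≤ 2 * Real.log 2 * (n - j₀) := by nlinarith
    calc Real.log T ≤ 2 * Real.log 2 * (n - j₀) := h5
      _ = 2 * Real.log 2 / c * (c * (n - j₀)) := by field_simp
      _ ≤ _ := by gcongr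

/-! ### The loop of initial data and the profiles of the wave -/

/-- A smooth step from `0` to `2π`, constant off `[-1/c, 1/c]`, for `c > 0`. -/
def loopPhase (c x : ℝ) : ℝ := 2 * Real.pi * Real.smoothTransition ((c * x + 1) / 2)

lemma contDiff_loopPhase (c : ℝ) : ContDiff ℝ ∞ (loopPhase c) := by
  have h : ContDiff ℝ ∞ Real.smoothTransition := Real.smoothTransition.contDiff
  unfold loopPhase
  fun_prop

lemma loopPhase_eq_zero {C x : ℝ} (hC : 0 < C) (hx : x ≤ -C) : loopPhase C⁻¹ x = 0 := by
  have : C⁻¹ * x ≤ -1 := by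
    rw [inv_mul_le_iff₀ hC]
    linarith
  rw [loopPhase, Real.smoothTransition.zero_of_nonpos (by linarith), mul_zero]

lemma loopPhase_eq_two_pi {C x : ℝ} (hC : 0 < C) (hx : C ≤ x) :
    loopPhase C⁻¹ x = 2 * Real.pi := by
  have : 1 ≤ C⁻¹ * x := by
    rw [le_inv_mul_iff₀ hC]
    linarith
  rw [loopPhase, Real.smoothTransition.one_of_one_le (by linarith), mul_one]

lemma exists_iteratedDeriv_loopPhase_bound : ∃ M : ℕ → ℝ, ∀ n x,
    |iteratedDeriv n (fun y => Real.cos (loopPhase 1 y) - 1) x| +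
      |iteratedDeriv n (fun y => Real.sin (loopPhase 1 y)) x| ≤ M n := by
  have key : ∀ {h : ℝ → ℝ}, ContDiff ℝ ∞ h → (∀ x, x ∉ Set.Icc (-1 : ℝ) 1 → h x = 0) → ∀ n,
      ∃ M, ∀ x, |iteratedDeriv n h x| ≤ M := by
    intro h hh h0 n
    have hs : HasCompactSupport h := HasCompactSupport.intro isCompact_Icc h0
    have hc : Continuous (iteratedFDeriv ℝ n h) :=
      hh.continuous_iteratedFDeriv (mod_cast le_top)
    obtain ⟨M, hM⟩ := (hs.iteratedFDeriv n).exists_bound_of_continuous hc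
    refine ⟨M, fun x => ?_⟩
    rw [← Real.norm_eq_abs, ← norm_iteratedFDeriv_eq_norm_iteratedDeriv]
    exact hM x
  have hphase : ∀ x, x ∉ Set.Icc (-1 : ℝ) 1 → loopPhase 1 x = 0 ∨ loopPhase 1 x = 2 * Real.pi := by
    intro x hx
    rw [Set.mem_Icc, not_and_or, not_le, not_le] at hx
    rw [← inv_one]
    exact hx.imp (fun h => loopPhase_eq_zero one_pos h.le)
      fun h => loopPhase_eq_two_pi one_pos h.le
  have hcd := contDiff_loopPhase 1
  choose M₁ hM₁ using key (h := fun y => Real.cos (loopPhase 1 y) - 1) (by fun_prop)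
    (fun x hx => by rcases hphase x hx with h | h <;> simp [h])
  choose M₂ hM₂ using key (h := fun y => Real.sin (loopPhase 1 y)) (by fun_prop)
    (fun x hx => by rcases hphase x hx with h | h <;> simp [h])
  exact ⟨fun n => M₁ n + M₂ n, fun n x => add_le_add (hM₁ n x) (hM₂ n x)⟩

/-- A frame of three orthonormal vectors, tilted so that `e₁` lies on the circle of latitude
traversed by the initial data. -/
lemma exists_tilted_frame {m : ℕ} (hm : 2 < m) (hm0 : 0 < m) {k c : ℝ} (hkc : c ^ 2 + k ^ 2 = 1) :
    ∃ a : Fin 3 → EuclideanSpace ℝ (Fin m), Orthonormal ℝ a ∧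
      frameSum a c k 0 = stdE1 m hm0 := by
  let e : Fin 3 → EuclideanSpace ℝ (Fin m) := fun i =>
    EuclideanSpace.single (⟨i, by omega⟩ : Fin m) (1 : ℝ)
  have he : Orthonormal ℝ e := by
    rw [orthonormal_iff_ite]
    intro i j
    rw [EuclideanSpace.inner_single_left]
    simp [e, Fin.ext_iff]
  have hin := orthonormal_iff_ite.1 he
  refine ⟨![c • e 0 - k • e 1, k • e 0 + c • e 1, e 2], ?_, ?_⟩
  · rw [orthonormal_iff_ite]
    intro i j
    fin_cases i <;> fin_cases j <;>
      simp [-inner_self_eq_norm_sq_to_K, inner_add_left,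
        inner_add_right, inner_sub_left, inner_sub_right, inner_smul_left, inner_smul_right,
        hin] <;> linarith
  · have h0 : e 0 = stdE1 m hm0 := rfl
    rw [← h0]
    simp only [frameSum, Matrix.cons_val_zero, Matrix.cons_val_one, Matrix.cons_val]
    have : c • (c • e 0 - k • e 1) + k • (k • e 0 + c • e 1) + (0 : ℝ) • e 2 =
        (c ^ 2 + k ^ 2) • e 0 := by module
    rw [this, hkc, one_smul]

section
variable {E : Type*} [NormedAddCommGroup E] [InnerProductSpace ℝ E] {a : Fin 3 → E} {k C : ℝ}
  {ψ : ℝ → ℝ}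

lemma pendulumMap_zero (hψ0 : ψ 0 = Real.pi / 2) (y : ℝ) :
    pendulumMap a k ψ 0 y =
      frameSum a (√(1 - k ^ 2)) (k * Real.cos y) (k * Real.sin y) := by
  simp [pendulumMap, hψ0, pendulumSpeed]

lemma pendulumMap_zero_sub (hψ0 : ψ 0 = Real.pi / 2) (y : ℝ) :
    pendulumMap a k ψ 0 y - frameSum a (√(1 - k ^ 2)) k 0 =
      k • ((Real.cos y - 1) • a 1 + Real.sin y • a 2) := by
  rw [pendulumMap_zero hψ0]
  simp only [frameSum]
  module

lemma norm_iteratedDeriv_loop_le (ha : Orthonormal ℝ a) (hk : 0 ≤ k) (hC : 0 < C)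
    (hψ0 : ψ 0 = Real.pi / 2) {M : ℕ → ℝ}
    (hM : ∀ n x, |iteratedDeriv n (fun y => Real.cos (loopPhase 1 y) - 1) x| +
      |iteratedDeriv n (fun y => Real.sin (loopPhase 1 y)) x| ≤ M n) (n : ℕ) (x : ℝ) :
    ‖iteratedDeriv n (fun y => pendulumMap a k ψ 0 (loopPhase C⁻¹ y) -
      frameSum a (√(1 - k ^ 2)) k 0) x‖ ≤ k * (C⁻¹ ^ n * M n) := by
  have hcd : ContDiff ℝ n (loopPhase 1) := contDiff_infty.1 (contDiff_loopPhase 1) n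
  have hcos : ContDiff ℝ n fun y => Real.cos (loopPhase 1 y) - 1 := by fun_prop
  have hsin : ContDiff ℝ n fun y => Real.sin (loopPhase 1 y) := by fun_prop
  have hscale : ∀ y, loopPhase C⁻¹ y = loopPhase 1 (C⁻¹ * y) := fun y => by simp [loopPhase]
  simp only [pendulumMap_zero_sub hψ0, hscale]
  have hcos' : ContDiff ℝ n fun y => Real.cos (loopPhase 1 (C⁻¹ * y)) - 1 := by fun_prop
  have hsin' : ContDiff ℝ n fun y => Real.sin (loopPhase 1 (C⁻¹ * y)) := by fun_prop
  rw [iteratedDeriv_fun_const_smul_field, iteratedDeriv_fun_add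
    (by fun_prop) (by fun_prop), iteratedDeriv_smul_const hcos'.contDiffAt,
    iteratedDeriv_smul_const hsin'.contDiffAt, iteratedDeriv_comp_const_mul hcos,
    iteratedDeriv_comp_const_mul hsin, norm_smul, Real.norm_of_nonneg hk]
  have hCn : 0 ≤ C⁻¹ ^ n := by positivity
  refine mul_le_mul_of_nonneg_left ((norm_add_le _ _).trans ?_) hk
  rw [norm_smul, norm_smul, ha.norm_eq_one, ha.norm_eq_one, mul_one, mul_one, norm_mul, norm_mul,
    Real.norm_of_nonneg hCn, ← mul_add]
  exact mul_le_mul_of_nonneg_left (hM n _) hCn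

lemma pendulumWave_of_le (hC : 0 < C) (hψ0 : ψ 0 = Real.pi / 2) {t x : ℝ} (hx : x ≤ -(C + |t|)) :
    pendulumWave a k ψ (loopPhase C⁻¹) t x = frameSum a (√(1 - k ^ 2)) k 0 := by
  have h1 := le_abs_self t
  have h2 := neg_abs_le t
  rw [pendulumWave, conformalTime, conformalSpace, loopPhase_eq_zero hC (x := x + t) (by linarith),
    loopPhase_eq_zero hC (x := x - t) (by linarith)]
  simp [pendulumMap_zero hψ0]

lemma pendulumWave_of_ge (hC : 0 < C) (hψ0 : ψ 0 = Real.pi / 2) {t x : ℝ} (hx : C + |t| ≤ x) :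
    pendulumWave a k ψ (loopPhase C⁻¹) t x = frameSum a (√(1 - k ^ 2)) k 0 := by
  have h1 := le_abs_self t
  have h2 := neg_abs_le t
  rw [pendulumWave, conformalTime, conformalSpace,
    loopPhase_eq_two_pi hC (x := x + t) (by linarith),
    loopPhase_eq_two_pi hC (x := x - t) (by linarith), sub_self, zero_div, pendulumMap_zero hψ0,
    show (2 * Real.pi + 2 * Real.pi) / 2 = 2 * Real.pi by ring]
  simp

/-- The left-moving profile that emerges from the loop: it connects the state `e₁` on its left with
the state of the pendulum at time `π` on its right. -/
def leftProfile (a : Fin 3 → E) (k : ℝ) (ψ : ℝ → ℝ) (C u : ℝ) : E :=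
  pendulumMap a k ψ (loopPhase C⁻¹ u / 2) (loopPhase C⁻¹ u / 2)

/-- The right-moving profile that emerges from the loop, with the state `e₁` on its right. -/
def rightProfile (a : Fin 3 → E) (k : ℝ) (ψ : ℝ → ℝ) (C v : ℝ) : E :=
  pendulumMap a k ψ ((2 * Real.pi - loopPhase C⁻¹ v) / 2) ((2 * Real.pi + loopPhase C⁻¹ v) / 2)

lemma contDiff_leftProfile (hk0 : 0 < k) (hk1 : k < 1) (hψ : ContDiff ℝ ∞ ψ) :
    ContDiff ℝ ∞ (leftProfile a k ψ C) := by
  have := contDiff_loopPhase C⁻¹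
  exact (contDiff_pendulumMap a hk0 hk1 hψ).comp
    (f := fun u => (loopPhase C⁻¹ u / 2, loopPhase C⁻¹ u / 2)) (by fun_prop)

lemma contDiff_rightProfile (hk0 : 0 < k) (hk1 : k < 1) (hψ : ContDiff ℝ ∞ ψ) :
    ContDiff ℝ ∞ (rightProfile a k ψ C) := by
  have := contDiff_loopPhase C⁻¹
  exact (contDiff_pendulumMap a hk0 hk1 hψ).comp
    (f := fun v => ((2 * Real.pi - loopPhase C⁻¹ v) / 2, (2 * Real.pi + loopPhase C⁻¹ v) / 2))
    (by fun_prop)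

lemma leftProfile_of_le (hC : 0 < C) (hψ0 : ψ 0 = Real.pi / 2) {u : ℝ} (hu : u ≤ -C) :
    leftProfile a k ψ C u = frameSum a (√(1 - k ^ 2)) k 0 := by
  rw [leftProfile, loopPhase_eq_zero hC hu]
  simp [pendulumMap_zero hψ0]

lemma leftProfile_of_ge (hC : 0 < C) {u : ℝ} (hu : C ≤ u) :
    leftProfile a k ψ C u = pendulumMap a k ψ Real.pi Real.pi := by
  rw [leftProfile, loopPhase_eq_two_pi hC hu, mul_div_cancel_left₀ _ two_ne_zero]

lemma rightProfile_of_le (hC : 0 < C) {v : ℝ} (hv : v ≤ -C) :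
    rightProfile a k ψ C v = pendulumMap a k ψ Real.pi Real.pi := by
  rw [rightProfile, loopPhase_eq_zero hC hv, sub_zero, add_zero,
    mul_div_cancel_left₀ _ two_ne_zero]

lemma rightProfile_of_ge (hC : 0 < C) (hψ0 : ψ 0 = Real.pi / 2) {v : ℝ} (hv : C ≤ v) :
    rightProfile a k ψ C v = frameSum a (√(1 - k ^ 2)) k 0 := by
  rw [rightProfile, loopPhase_eq_two_pi hC hv, sub_self, zero_div, pendulumMap_zero hψ0,
    show (2 * Real.pi + 2 * Real.pi) / 2 = 2 * Real.pi by ring]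
  simp

/-- After time `C` the wave consists of two separating profiles, constant in between. -/
lemma pendulumWave_eq_profiles (hC : 0 < C) {t : ℝ} (ht : C ≤ t) (x : ℝ) :
    pendulumWave a k ψ (loopPhase C⁻¹) t x =
      leftProfile a k ψ C (x + t) + rightProfile a k ψ C (x - t) -
        pendulumMap a k ψ Real.pi Real.pi := by
  rcases le_total x 0 with hx | hx
  · rw [rightProfile_of_le hC (v := x - t) (by linarith), add_sub_cancel_right, pendulumWave,
      leftProfile, conformalTime, conformalSpace, loopPhase_eq_zero hC (x := x - t) (by linarith),
      sub_zero, add_zero]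
  · rw [leftProfile_of_ge hC (u := x + t) (by linarith), add_sub_cancel_left, pendulumWave,
      rightProfile, conformalTime, conformalSpace,
      loopPhase_eq_two_pi hC (x := x + t) (by linarith)]

/-- The state left behind between the two profiles is not `e₁`, since the half period of the
pendulum is longer than `π`. -/
lemma pendulumMap_pi_ne (ha : Orthonormal ℝ a) (hk0 : 0 < k) (hk1 : k < 1)
    (hψ0 : ψ 0 = Real.pi / 2) (hψ : ∀ t, HasDerivAt ψ (pendulumSpeed k (ψ t)) t) :
    pendulumMap a k ψ Real.pi Real.pi ≠ frameSum a (√(1 - k ^ 2)) k 0 := by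
  intro h
  have hsin := neg_one_lt_sin_pendulum_phase_pi hk0 hk1 hψ0 hψ
  have h2 : ‖pendulumMap a k ψ Real.pi Real.pi - frameSum a (√(1 - k ^ 2)) k 0‖ ^ 2 = 0 := by
    rw [h, sub_self]; simp
  have e : pendulumMap a k ψ Real.pi Real.pi - frameSum a (√(1 - k ^ 2)) k 0 =
      frameSum a (pendulumSpeed k (ψ Real.pi) - √(1 - k ^ 2))
        (-(k * (Real.sin (ψ Real.pi) + 1))) 0 := by
    simp only [pendulumMap, frameSum, Real.cos_pi, Real.sin_pi]
    module
  rw [e, norm_frameSum_sq ha] at h2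
  have h3 : 0 < k * (Real.sin (ψ Real.pi) + 1) := mul_pos hk0 (by linarith)
  nlinarith [sq_nonneg (pendulumSpeed k (ψ Real.pi) - √(1 - k ^ 2))]
end

/-! ### Growth of the norms -/

/-- The `i`-th coordinate of a vector-valued function, as a complex-valued function. -/
def complexCoord {m : ℕ} (g : ℝ → EuclideanSpace ℝ (Fin m)) (i : Fin m) (x : ℝ) : ℂ :=
  ((g x i : ℝ) : ℂ)

section coordinates
variable {m : ℕ} {g : ℝ → EuclideanSpace ℝ (Fin m)}

lemma contDiff_complexCoord (hg : ContDiff ℝ ∞ g) (i : Fin m) :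
    ContDiff ℝ ∞ (complexCoord g i) :=
  Complex.ofRealCLM.contDiff.comp (contDiff_euclidean.1 hg i)

lemma hasCompactSupport_complexCoord (hg : HasCompactSupport g) (i : Fin m) :
    HasCompactSupport (complexCoord g i) :=
  hg.comp_left (g := fun v : EuclideanSpace ℝ (Fin m) => ((v i : ℝ) : ℂ)) (by simp)

lemma norm_complexCoord_le (i : Fin m) (x : ℝ) : ‖complexCoord g i x‖ ≤ ‖g x‖ := by
  rw [complexCoord, Complex.norm_real]
  exact PiLp.norm_apply_le (g x) i

lemma continuous_fourierNormSq (hg : ContDiff ℝ ∞ g) (hs : HasCompactSupport g) :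
    Continuous (fourierNormSq g) :=
  continuous_finsetSum _ fun i _ => ((continuous_fourier_of_integrable
    ((contDiff_complexCoord hg i).continuous.integrable_of_hasCompactSupport
      (hasCompactSupport_complexCoord hs i))).norm.pow 2)

lemma fourierDecay_of_complexCoord {K : Fin m → ℝ} {T : ℝ}
    (h : ∀ i ξ, ‖𝓕 (complexCoord g i) ξ‖ ≤ K i * T ∧ |ξ| * ‖𝓕 (complexCoord g i) ξ‖ ≤ K i ∧
      |ξ| ^ 2 * ‖𝓕 (complexCoord g i) ξ‖ ≤ K i) :
    FourierDecay (fourierNormSq g) (∑ i, K i ^ 2) T := by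
  have hN : ∀ ξ, fourierNormSq g ξ = ∑ i, ‖𝓕 (complexCoord g i) ξ‖ ^ 2 := fun ξ => rfl
  refine ⟨fun ξ => ?_, fun ξ => ?_, fun ξ => ?_⟩
  · rw [hN, Finset.sum_mul]
    refine Finset.sum_le_sum fun i _ => ?_
    rw [← mul_pow]
    exact pow_le_pow_left₀ (by positivity) (h i ξ).1 2
  · rw [hN, Finset.mul_sum]
    refine Finset.sum_le_sum fun i _ => ?_
    rw [← mul_pow]
    exact pow_le_pow_left₀ (by positivity) (h i ξ).2.1 2
  · rw [hN, Finset.mul_sum]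
    refine Finset.sum_le_sum fun i _ => ?_
    rw [show |ξ| ^ 4 = (|ξ| ^ 2) ^ 2 by ring, ← mul_pow]
    exact pow_le_pow_left₀ (by positivity) (h i ξ).2.2 2

lemma homNorms_ne_top (hg : ContDiff ℝ ∞ g) (hs : HasCompactSupport g) :
    homSobolevNorm (1 / 2) g ≠ ⊤ ∧ homBesovNorm (1 / 2) g ≠ ⊤ := by
  choose K hK using fun i => exists_fourier_decay_two (contDiff_complexCoord hg i)
    (hasCompactSupport_complexCoord hs i)
  obtain ⟨W, -, hW⟩ := exists_norm_le_of_fourierDecay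
  obtain ⟨h1, h2⟩ := hW (n := 0) (T := 1) (Finset.sum_nonneg fun i _ => sq_nonneg (K i))
    zero_le_one (by simp) (fourierDecay_of_complexCoord (g := g) fun i ξ => by
      rw [mul_one]; exact hK i ξ)
  refine ⟨?_, (h1.trans_lt ENNReal.ofReal_lt_top).ne⟩
  rw [homSobolevNorm_half]
  exact ENNReal.rpow_ne_top_of_nonneg (by norm_num) (h2.trans_lt ENNReal.ofReal_lt_top).ne

lemma integral_norm_complexCoord_le {R : ℝ} (hR : 0 ≤ R) (hb : ∀ x, ‖g x‖ ≤ 2)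
    (h0 : ∀ x, x ∉ Set.Icc (-R) R → g x = 0) (i : Fin m) :
    ∫ x, ‖complexCoord g i x‖ ≤ 4 * R := by
  have h0' : ∀ x, x ∉ Set.Icc (-R) R → ‖complexCoord g i x‖ = 0 := fun x hx => by
    simp [complexCoord, h0 x hx]
  rw [← setIntegral_eq_integral_of_forall_compl_eq_zero h0']
  have h := norm_setIntegral_le_of_norm_le_const (μ := volume) (s := Set.Icc (-R) R)
    (f := fun x => ‖complexCoord g i x‖) (C := 2) (by simp)
    (fun x _ => by rw [norm_norm]; exact (norm_complexCoord_le i x).trans (hb x))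
  refine (Real.le_norm_self _).trans (h.trans_eq ?_)
  rw [Real.volume_real_Icc_of_le (by linarith)]
  ring
end coordinates

lemma hasCompactSupport_deriv_of_eq_const {f : ℝ → ℂ} {C : ℝ} {p q : ℂ}
    (hl : ∀ x, x ≤ -C → f x = p) (hr : ∀ x, C ≤ x → f x = q) : HasCompactSupport (deriv f) := by
  refine HasCompactSupport.intro (isCompact_Icc (a := -C) (b := C)) fun x hx => ?_
  rw [Set.mem_Icc, not_and_or, not_le, not_le] at hx
  rcases hx with hx | hx
  · have : f =ᶠ[𝓝 x] fun _ => p := (eventually_lt_nhds hx).mono fun y hy => hl y hy.le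
    rw [this.deriv_eq, deriv_const]
  · have : f =ᶠ[𝓝 x] fun _ => q := (eventually_gt_nhds hx).mono fun y hy => hr y hy.le
    rw [this.deriv_eq, deriv_const]

/-- A wave that at time `T` equals `p - q` between two profiles near `-T` and `T`, and zero outside
them, has `Ḣ^{1/2}` norm of order `√(log T)` and `Ḃ^{1/2,1}_2` norm of order `log T`. -/
theorem isTheta_norms_of_separating_profiles {m : ℕ}
    {g : ℝ → ℝ → EuclideanSpace ℝ (Fin m)} {l r : ℝ → EuclideanSpace ℝ (Fin m)}
    {p q : EuclideanSpace ℝ (Fin m)} {C : ℝ} (hC : 0 < C) (hpq : p ≠ q)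
    (hl : ContDiff ℝ ∞ l) (hr : ContDiff ℝ ∞ r)
    (hlq : ∀ x, x ≤ -C → l x = q) (hlp : ∀ x, C ≤ x → l x = p)
    (hrp : ∀ x, x ≤ -C → r x = p) (hrq : ∀ x, C ≤ x → r x = q)
    (hg : ∀ T, ContDiff ℝ ∞ (g T)) (hb : ∀ T x, ‖g T x‖ ≤ 2)
    (h0 : ∀ T x, x ∉ Set.Icc (-(C + |T|)) (C + |T|) → g T x = 0)
    (hsep : ∀ T, C ≤ T → ∀ x, g T x = l (x + T) + r (x - T) - (p + q)) :
    (fun T => (homSobolevNorm (1 / 2) (g T)).toReal) =Θ[atTop] (fun T => √(Real.log T)) ∧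
    (fun T => (homBesovNorm (1 / 2) (g T)).toReal) =Θ[atTop] Real.log := by
  have hs : ∀ T, HasCompactSupport (g T) := fun T => HasCompactSupport.intro isCompact_Icc (h0 T)
  have hcoord : ∀ T, C ≤ T → ∀ i, complexCoord (g T) i =
      travellingPair (complexCoord l i) (complexCoord r i) ((p i + q i : ℝ) : ℂ) T := by
    intro T hT i
    funext x
    simp [complexCoord, travellingPair, hsep T hT x]
  have hint : ∀ T i, Integrable (complexCoord (g T) i) := fun T i =>
    (contDiff_complexCoord (hg T) i).continuous.integrable_of_hasCompactSupport
      (hasCompactSupport_complexCoord (hs T) i)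
  have hlc := contDiff_complexCoord hl
  have hrc := contDiff_complexCoord hr
  have hls : ∀ i, HasCompactSupport (deriv (complexCoord l i)) := fun i =>
    hasCompactSupport_deriv_of_eq_const (p := ((q i : ℝ) : ℂ)) (q := ((p i : ℝ) : ℂ))
      (fun x hx => by rw [complexCoord, hlq x hx]) (fun x hx => by rw [complexCoord, hlp x hx])
  have hrs : ∀ i, HasCompactSupport (deriv (complexCoord r i)) := fun i =>
    hasCompactSupport_deriv_of_eq_const (p := ((p i : ℝ) : ℂ)) (q := ((q i : ℝ) : ℂ))
      (fun x hx => by rw [complexCoord, hrp x hx]) (fun x hx => by rw [complexCoord, hrq x hx])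
  -- upper bounds, with constants independent of `T`
  choose K hK using fun i => exists_fourier_decay_travellingPair (hlc i) (hrc i) (hls i) (hrs i)
    ((p i + q i : ℝ) : ℂ)
  have hdecay : ∀ T, C ≤ T → FourierDecay (fourierNormSq (g T)) (∑ i, (max 8 (K i)) ^ 2) T := by
    intro T hT
    refine fourierDecay_of_complexCoord fun i ξ => ?_
    have h := hK i T (hcoord T hT i ▸ hint T i) ξ
    rw [← hcoord T hT i] at h
    refine ⟨?_, h.1.trans (le_max_right _ _), h.2.trans (le_max_right _ _)⟩
    have hT0 : 0 < T := hC.trans_le hT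
    refine (norm_fourier_le_integral_norm _ ξ).trans ((integral_norm_complexCoord_le
      (by positivity) (hb T) (h0 T) i).trans ?_)
    rw [abs_of_pos hT0]
    nlinarith [le_max_left 8 (K i)]
  have hK0 : 0 ≤ ∑ i, (max 8 (K i)) ^ 2 := Finset.sum_nonneg fun i _ => sq_nonneg _
  -- lower bounds, from a coordinate in which the two constant states differ
  obtain ⟨i, hi⟩ : ∃ i, p i ≠ q i := by
    by_contra! h
    exact hpq (PiLp.ext h)
  have hbot : ∀ᶠ x : ℝ in atBot, x ≤ -C := eventually_le_atBot _
  have htop : ∀ᶠ x : ℝ in atTop, C ≤ x := eventually_ge_atTop _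
  have hld : ∫ x, deriv (complexCoord l i) x = ((p i - q i : ℝ) : ℂ) := by
    rw [integral_deriv_eq_sub_of_eventually_const (contDiff_infty.1 (hlc i) 1) (hls i)
      (hbot.mono fun x hx => by rw [complexCoord, hlq x hx])
      (htop.mono fun x hx => by rw [complexCoord, hlp x hx])]
    push_cast; rfl
  have hrd : ∫ x, deriv (complexCoord r i) x = -((p i - q i : ℝ) : ℂ) := by
    rw [integral_deriv_eq_sub_of_eventually_const (contDiff_infty.1 (hrc i) 1) (hrs i)
      (hbot.mono fun x hx => by rw [complexCoord, hrp x hx])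
      (htop.mono fun x hx => by rw [complexCoord, hrq x hx])]
    push_cast; ring
  obtain ⟨B, hB0, hB⟩ := exists_le_fourier_travellingPair (hlc i) (hrc i) (hls i) (hrs i) hld hrd
    ((p i + q i : ℝ) : ℂ)
  have hd : 0 < |p i - q i| := abs_pos.2 (sub_ne_zero.2 hi)
  set d := |p i - q i| with hddef
  have hpi := Real.pi_pos
  have hlower : ∀ T, C ≤ T → ∀ ξ, d ^ 2 / (2 * Real.pi ^ 2) * Real.sin (2 * Real.pi * T * ξ) ^ 2 -
      B ^ 2 / (4 * Real.pi ^ 2) * ξ ^ 2 ≤ ξ ^ 2 * fourierNormSq (g T) ξ := by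
    intro T hT ξ
    have h := hB T (hcoord T hT i ▸ hint T i) ξ
    rw [← hcoord T hT i, Complex.norm_real, Real.norm_eq_abs, ← hddef] at h
    have hN : ‖𝓕 (complexCoord (g T) i) ξ‖ ^ 2 ≤ fourierNormSq (g T) ξ :=
      Finset.single_le_sum (f := fun i => ‖𝓕 (complexCoord (g T) i) ξ‖ ^ 2)
        (fun i _ => by positivity) (Finset.mem_univ i)
    refine le_trans ?_ (mul_le_mul_of_nonneg_left hN (sq_nonneg ξ))
    set G := ‖𝓕 (complexCoord (g T) i) ξ‖
    set s := Real.sin (2 * Real.pi * T * ξ)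
    have h1 : (2 * d * |s|) ^ 2 ≤ (B * |ξ| + 2 * Real.pi * (|ξ| * G)) ^ 2 :=
      pow_le_pow_left₀ (by positivity) (by linarith) 2
    have h2 : (B * |ξ| + 2 * Real.pi * (|ξ| * G)) ^ 2 ≤
        2 * (B * |ξ|) ^ 2 + 2 * (2 * Real.pi * (|ξ| * G)) ^ 2 := by
      nlinarith [sq_nonneg (B * |ξ| - 2 * Real.pi * (|ξ| * G))]
    simp only [mul_pow, sq_abs] at h1 h2
    have e : d ^ 2 / (2 * Real.pi ^ 2) * s ^ 2 - B ^ 2 / (4 * Real.pi ^ 2) * ξ ^ 2 =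
        (4 * (d ^ 2 * s ^ 2) - 2 * (B ^ 2 * ξ ^ 2)) / (8 * Real.pi ^ 2) := by
      field_simp
      ring
    rw [e, div_le_iff₀ (by positivity)]
    nlinarith
  have ha : 0 < d ^ 2 / (2 * Real.pi ^ 2) := by positivity
  obtain ⟨W, hW0, hW⟩ := exists_norm_le_of_fourierDecay
  obtain ⟨j₀, hj₀⟩ := exists_le_norm_of_fourier_lower (b := B ^ 2 / (4 * Real.pi ^ 2)) ha
  have hup := fun (n : ℕ) (T : ℝ) (hT : C ≤ T) (hn : T ≤ 2 ^ (n + 1)) =>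
    hW (g := g T) hK0 (hC.le.trans hT) hn (hdecay T hT)
  have hlo := fun (n : ℕ) (T : ℝ) (hT : C ≤ T) (hn : 2 ^ n ≤ T) =>
    hj₀ (continuous_fourierNormSq (hg T) (hs T)) hn (hlower T hT)
  have hcast : ∀ n : ℕ, W + ((n + 1 : ℕ) : ℝ) = (W + 1) + n := fun n => by push_cast; ring
  have hE : (fun T => (homSobolevEnergy (g T)).toReal) =Θ[atTop] Real.log :=
    isTheta_log_of_dyadic_bounds (by positivity) fun n T hT h1 h2 =>
      ⟨(hlo n T hT h1).2, hcast n ▸ (hup n T hT h2).2⟩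
  have hBesov : (fun T => (homBesovNorm (1 / 2) (g T)).toReal) =Θ[atTop] Real.log :=
    isTheta_log_of_dyadic_bounds (by positivity) fun n T hT h1 h2 =>
      ⟨(hlo n T hT h1).1, hcast n ▸ (hup n T hT h2).1⟩
  refine ⟨?_, hBesov⟩
  have hlog : 0 ≤ᶠ[atTop] Real.log :=
    (eventually_ge_atTop 1).mono fun T hT => Real.log_nonneg hT
  have := hE.sqrt (Eventually.of_forall fun T => ENNReal.toReal_nonneg) hlog
  simpa only [homSobolevNorm_half, ← ENNReal.toReal_rpow, Real.sqrt_eq_rpow] using this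

end

theorem theorem2 (m : ℕ) (hm : 2 < m) :
    -- the implied constants depend only on the order of the derivative (and on the target)
    ∃ A : ℕ → ℝ, ∀ ε : ℝ, 0 < ε → ∀ C : ℝ, 0 < C →
      ∃ f : ℝ → EuclideanSpace ℝ (Fin m),
        -- smooth initial data on the sphere, close to `e₁`, and equal to `e₁` off `[-C, C]`
        ContDiff ℝ ∞ f ∧
        (∀ x : ℝ, ‖f x‖ = 1) ∧
        (∀ (k : ℕ) (x : ℝ),
          ‖iteratedDeriv k (fun y => f y - stdE1 m (by omega)) x‖ ≤ A k * ε) ∧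
        tsupport (fun y => f y - stdE1 m (by omega)) ⊆ Set.Icc (-C) C ∧
        -- the smooth global solution exists, is unique, and is a map into the sphere
        ∃ φ : ℝ → ℝ → EuclideanSpace ℝ (Fin m),
          IsSmoothWaveMapSolution f φ ∧
          (∀ ψ : ℝ → ℝ → EuclideanSpace ℝ (Fin m), IsSmoothWaveMapSolution f ψ → ψ = φ) ∧
          (∀ t x : ℝ, ‖φ t x‖ = 1) ∧
          -- at each time the norms are those of an integrable function, and they are finite
          (∀ T : ℝ, Integrable (fun x => φ T x - stdE1 m (by omega)) ∧
            homSobolevNorm (1 / 2) (fun x => φ T x - stdE1 m (by omega)) ≠ ⊤ ∧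
            homBesovNorm (1 / 2) (fun x => φ T x - stdE1 m (by omega)) ≠ ⊤) ∧
          -- both norms tend to infinity
          Tendsto (fun T : ℝ =>
            (homSobolevNorm (1 / 2) (fun x => φ T x - stdE1 m (by omega))).toReal) atTop atTop ∧
          Tendsto (fun T : ℝ =>
            (homBesovNorm (1 / 2) (fun x => φ T x - stdE1 m (by omega))).toReal) atTop atTop ∧
          -- and they grow like `(log T)^{1/2}` and `log T`
          Asymptotics.IsTheta atTop (fun T : ℝ =>
            (homSobolevNorm (1 / 2) (fun x => φ T x - stdE1 m (by omega))).toReal)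
            (fun T : ℝ => Real.sqrt (Real.log T)) ∧
          Asymptotics.IsTheta atTop (fun T : ℝ =>
            (homBesovNorm (1 / 2) (fun x => φ T x - stdE1 m (by omega))).toReal)
            (fun T : ℝ => Real.log T) := by
  obtain ⟨M, hM⟩ := exists_iteratedDeriv_loopPhase_bound
  have hM0 : ∀ n, 0 ≤ M n := fun n => le_trans (by positivity) (hM n 0)
  refine ⟨fun n => n.factorial * M n, fun ε hε C hC => ?_⟩
  -- the factor `exp (-1/C)` absorbs the powers of `1/C` produced by differentiation
  obtain ⟨k, hk0, hk1, hkε⟩ : ∃ k : ℝ, 0 < k ∧ k < 1 ∧ k ≤ ε * Real.exp (-C⁻¹) := by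
    have hexp : Real.exp (-C⁻¹) < 1 := by simpa using hC
    have hpos := Real.exp_pos (-C⁻¹)
    refine ⟨min ε 1 * Real.exp (-C⁻¹), by positivity, ?_, by gcongr; exact min_le_left _ _⟩
    calc min ε 1 * Real.exp (-C⁻¹) ≤ 1 * Real.exp (-C⁻¹) := by gcongr; exact min_le_right _ _
      _ < 1 := by rwa [one_mul]
  obtain ⟨ψ, hψ0, hψ⟩ := exists_pendulum_phase hk0 hk1
  have hψs := contDiff_of_autonomous_ode (contDiff_pendulumSpeed hk0 hk1) hψ
  obtain ⟨a, ha, hae⟩ := exists_tilted_frame hm (by omega) (k := k) (c := √(1 - k ^ 2)) (by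
    rw [Real.sq_sqrt (by nlinarith)]; ring)
  rw [← hae]
  have hsol := isSmoothWaveMapSolution_pendulumWave ha hk0 hk1 hψ hψ0 (contDiff_loopPhase C⁻¹)
  set φ := pendulumWave a k ψ (loopPhase C⁻¹) with hφ
  have hnorm : ∀ t x, ‖φ t x‖ = 1 := fun t x => norm_pendulumMap ha hk0 hk1 ψ _ _
  have hq : ‖frameSum a (√(1 - k ^ 2)) k 0‖ = 1 := by
    rw [hae]; simp [stdE1]
  have hsmooth : ∀ T, ContDiff ℝ ∞ fun x => φ T x - frameSum a (√(1 - k ^ 2)) k 0 := fun T =>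
    (hsol.smooth.comp (f := fun x : ℝ => (T, x)) (by fun_prop)).sub contDiff_const
  have hzero : ∀ T x, x ∉ Set.Icc (-(C + |T|)) (C + |T|) →
      φ T x - frameSum a (√(1 - k ^ 2)) k 0 = 0 := by
    intro T x hx
    rw [Set.mem_Icc, not_and_or, not_le, not_le] at hx
    rw [sub_eq_zero]
    rcases hx with h | h
    · exact pendulumWave_of_le hC hψ0 h.le
    · exact pendulumWave_of_ge hC hψ0 h.le
  have hsupp : ∀ T, HasCompactSupport fun x => φ T x - frameSum a (√(1 - k ^ 2)) k 0 := fun T =>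
    HasCompactSupport.intro isCompact_Icc (hzero T)
  obtain ⟨hΘS, hΘB⟩ := isTheta_norms_of_separating_profiles
    (g := fun T x => φ T x - frameSum a (√(1 - k ^ 2)) k 0) hC
    (pendulumMap_pi_ne ha hk0 hk1 hψ0 hψ) (contDiff_leftProfile (C := C) hk0 hk1 hψs)
    (contDiff_rightProfile (C := C) hk0 hk1 hψs) (fun x hx => leftProfile_of_le hC hψ0 hx)
    (fun x hx => leftProfile_of_ge hC hx) (fun x hx => rightProfile_of_le hC hx)
    (fun x hx => rightProfile_of_ge hC hψ0 hx) hsmooth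
    (fun T x => (norm_sub_le _ _).trans_eq (by rw [hnorm, hq]; norm_num)) hzero
    (fun T hT x => by rw [hφ, pendulumWave_eq_profiles hC hT]; abel)
  have hsqrt : Tendsto (fun T => ‖√(Real.log T)‖) atTop atTop :=
    tendsto_norm_atTop_atTop.comp (Real.tendsto_sqrt_atTop.comp Real.tendsto_log_atTop)
  have hlog : Tendsto (fun T => ‖Real.log T‖) atTop atTop :=
    tendsto_norm_atTop_atTop.comp Real.tendsto_log_atTop
  refine ⟨_, ?_, fun x => norm_pendulumMap ha hk0 hk1 ψ _ _, fun n x => ?_, ?_, φ, hsol,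
    fun _ hψ' => hsol.unique hψ', hnorm,
    fun T => ⟨(hsmooth T).continuous.integrable_of_hasCompactSupport (hsupp T),
      homNorms_ne_top (hsmooth T) (hsupp T)⟩, ?_, ?_, hΘS, hΘB⟩
  · exact (contDiff_pendulumMap a hk0 hk1 hψs).comp (f := fun x => ((0 : ℝ), loopPhase C⁻¹ x))
      (contDiff_const.prodMk (contDiff_loopPhase C⁻¹))
  · refine (norm_iteratedDeriv_loop_le ha hk0.le hC hψ0 hM n x).trans ?_
    have hfac : C⁻¹ ^ n ≤ n.factorial * Real.exp C⁻¹ := by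
      have := Real.pow_div_factorial_le_exp C⁻¹ (inv_nonneg.2 hC.le) n
      rwa [div_le_iff₀' (by positivity)] at this
    calc k * (C⁻¹ ^ n * M n)
        ≤ ε * Real.exp (-C⁻¹) * (n.factorial * Real.exp C⁻¹ * M n) := by
          have := hM0 n
          gcongr
      _ = n.factorial * M n * ε * (Real.exp (-C⁻¹) * Real.exp C⁻¹) := by ring
      _ = n.factorial * M n * ε := by rw [← Real.exp_add, neg_add_cancel, Real.exp_zero, mul_one]
  · refine closure_minimal (fun x hx => ?_) isClosed_Icc
    by_contra hx'
    refine hx ?_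
    have := hzero 0 x (by simpa using hx')
    rwa [hsol.initial_position] at this
  · simpa only [Function.comp_def, Real.norm_of_nonneg ENNReal.toReal_nonneg] using
      hΘS.tendsto_norm_atTop_iff.2 hsqrt
  · simpa only [Function.comp_def, Real.norm_of_nonneg ENNReal.toReal_nonneg] using
      hΘB.tendsto_norm_atTop_iff.2 hlog
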